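/- **Setting.** Let $\overline{\mathbb{G}}$ be a connected, locally finite simple graph with a distinguished vertex $0$, graph distance $d$ and closed balls $\mathbb{B}(x,\rho)$. Fix a (deterministic) subgraph $\mathbb{G}_0$ of $\overline{\mathbb{G}}$ that contains all vertices of $\overline{\mathbb{G}}$ and all edges of $\overline{\mathbb{G}}$ at $0$. For a subgraph $\mathbb{G}$ of $\overline{\mathbb{G}}$ with the same vertex set, put $\partial\mathbb{G}=\{z:\deg_{\mathbb{G}}(z)<\deg_{\overline{\mathbb{G}}}(z)\}$. Fix $c<1$ and a function $r$ on the vertices with $1\le r(x)\le\max(1,c\,d(x,0))$ for all $x$, and put $\mathcal{C}(x)=\mathbb{B}(x,r(x))$. Write $\mathbb{P}_y$ for the law of simple random walk (SRW) on $\overline{\mathbb{G}}$ started at $y$. On a probability space with a filtration $(\mathcal{F}_t)_{t\ge0}$ consider adapted sequences of vertices $Y_t$, with $Y_0=0$, and of subgraphs $\mathbb{G}_t$ of $\overline{\mathbb{G}}$, starting at $\mathbb{G}_0$ and non-decreasing in $t$, such that $\mathbb{G}_{t+1}=\mathbb{G}_t$ if $Y_t\notin\partial\mathbb{G}_t$,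 while if $Y_t\in\partial\mathbb{G}_t$ then both end points of every edge of $\mathbb{G}_{t+1}$ that is not in $\mathbb{G}_t$ lie in $\mathbb{B}(Y_t,1)$. This interaction is - *open by touch* if, whenever $Y_t\in\partial\mathbb{G}_t$, all edges of $\overline{\mathbb{G}}$ at $Y_t$ belong to $\mathbb{G}_{t+1}$; - *partially open by touch* if there is $\varepsilon>0$ such that, for all $t$, on $\{Y_t\in\partial\mathbb{G}_t\}$ the conditional probability given $\mathcal{F}_t$ that $\mathbb{G}_{t+1}$ contains an edge at $Y_t$ that is not in $\mathbb{G}_t$ is a.s. at least $\varepsilon$. The process $Y_t$ is an *extended simple random walk* if, for all $t$, a.s. on $\{Y_t\notin\partial\mathbb{G}_t\}$ the conditional law of $Y_{t+1}$ given $\mathcal{F}_t$ is uniform on the neighbours of $Y_t$ in $\overline{\mathbb{G}}$, and a.s. on $\{Y_t\in\partial\mathbb{G}_t\}$ one has $Y_{t+1}\in\mathcal{C}(Y_t)$ (with no other restriction on the choice of $Y_{t+1}$). Its sample path is *transient* if it visits every vertex only finitely often. **Proposition 1.6 (label obstacles).** Suppose that SRW on $\overline{\mathbb{G}}$ is transient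 and that $$S_\star:=\sum_{x\in\partial\mathbb{G}_0}\ \sup_{y\in\mathcal{C}(x)}\mathbb{P}_y(\text{SRW on }\overline{\mathbb{G}}\text{ ever hits }0)<\infty .$$ Then the sample path of every open by touch extended simple random walk is a.s. transient. If moreover the degrees of $\overline{\mathbb{G}}$ are uniformly bounded, then the sample path of every partially open by touch extended simple random walk is a.s. transient. In the case $\overline{\mathbb{G}}=\mathbb{Z}^d$ (nearest-neighbour graph), $d\ge3$, let $\mathbb{D}_0$ be the initial graph $\mathbb{G}_0$ and let $N(k)$ be the number of vertices of $\partial\mathbb{D}_0$ on the boundary of the box $[-k/2,k/2]^d$. If $\sum_{k\ge1}N(k)\,k^{2-d}<\infty$, then the sample path of every partially open by touch extended simple random walk is a.s. transient. -/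

import Mathlib

open MeasureTheory ProbabilityTheory
open scoped ENNReal

noncomputable section

namespace GrowingWalk

/-! ### Simple random walk on a fixed graph -/

section SRW

variable {V : Type*} [MeasurableSpace V] [DiscreteMeasurableSpace V]

open Classical in
/-- One-step transition law of simple random walk: the uniform distribution on the neighbours
of `x`. (At a vertex with no neighbour, or infinitely many, the walk stays put by convention; this
never matters on a connected locally finite graph with at least two vertices.) -/
def srwStep (G : SimpleGraph V) (x : V) : Measure V :=
  if (G.neighborSet x).Finite ∧ (G.neighborSet x).Nonempty then
    uniformOn (G.neighborSet x)
  else Measure.dirac x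

instance (G : SimpleGraph V) (x : V) : IsProbabilityMeasure (srwStep G x) := by
  unfold srwStep
  split_ifs with h
  · exact isProbabilityMeasure_uniformOn h.1 h.2
  · infer_instance

/-- The transition kernel of simple random walk on `G`. -/
def srwKernel (G : SimpleGraph V) : Kernel V V where
  toFun := srwStep G
  measurable' := Measurable.of_discrete

instance (G : SimpleGraph V) : IsMarkovKernel (srwKernel G) :=
  ⟨fun x => inferInstanceAs (IsProbabilityMeasure (srwStep G x))⟩

/-- The kernel giving the next position of simple random walk from its past: it only looks at the
present position. -/
def srwHistoryKernel (G : SimpleGraph V) (n : ℕ) :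
    Kernel ((i : Finset.Iic n) → (fun _ : ℕ => V) i) ((fun _ : ℕ => V) (n + 1)) :=
  (srwKernel G).comap (fun h => h ⟨n, Finset.mem_Iic.mpr le_rfl⟩) (measurable_pi_apply _)

instance (G : SimpleGraph V) (n : ℕ) : IsMarkovKernel (srwHistoryKernel G n) :=
  inferInstanceAs (IsMarkovKernel ((srwKernel G).comap _ _))

/-- The law `ℙ_y` on path space of simple random walk on `G` started at `y`. -/
def srwLaw (G : SimpleGraph V) (y : V) : Measure (ℕ → V) :=
  Kernel.trajMeasure (X := fun _ => V) (Measure.dirac y) (srwHistoryKernel G)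

/-- `ℙ_y (SRW on G ever hits o)`. -/
def hitProb (G : SimpleGraph V) (o y : V) : ℝ≥0∞ :=
  srwLaw G y {w | ∃ n, w n = o}

/-- Simple random walk on `G` is transient at `o`: started at `o`, it almost surely visits `o`
only finitely often. (For connected `G` this does not depend on `o`.) -/
def SRWTransient (G : SimpleGraph V) (o : V) : Prop :=
  ∀ᵐ w ∂(srwLaw G o), {n | w n = o}.Finite

end SRW

/-! ### Boundaries and balls -/

section Graph

variable {V : Type*}

/-- The boundary `{z : deg_H z < deg_Gbar z}` of a spanning subgraph `H` of the locally
finite graph `Gbar`. -/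
def boundary (Gbar H : SimpleGraph V) : Set V :=
  {z | (H.neighborSet z).ncard < (Gbar.neighborSet z).ncard}

/-- The closed ball of (real) radius `r` around `x` in the graph distance of the
connected graph `G`. -/
def ball (G : SimpleGraph V) (x : V) (r : ℝ) : Set V :=
  {y | (G.dist x y : ℝ) ≤ r}

/-- Admissible radii for the jumps of an extended simple random walk:
`1 ≤ r x ≤ max 1 (c * d(x, o))` for some constant `c < 1`. -/
def IsJumpRadius (Gbar : SimpleGraph V) (o : V) (r : V → ℝ) : Prop :=
  ∃ c < (1 : ℝ), ∀ x, 1 ≤ r x ∧ r x ≤ max 1 (c * Gbar.dist x o)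

variable [MeasurableSpace V] [DiscreteMeasurableSpace V]

/-- `S⋆`, the sum over `x ∈ ∂G0` of the supremum over `y` in the ball `C(x)` of radius `r x` around
`x` of the probability that simple random walk on `Gbar` started at `y` ever hits `o`. -/
def Sstar (Gbar G0 : SimpleGraph V) (o : V) (r : V → ℝ) : ℝ≥0∞ :=
  ∑' x : boundary Gbar G0, ⨆ y ∈ ball Gbar (x : V) (r x), hitProb Gbar o y

end Graph

/-! ### Interacting walks on growing spanning subgraphs -/

section Model

variable {V Ω : Type*} [MeasurableSpace V] [DiscreteMeasurableSpace V] {mΩ : MeasurableSpace Ω}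

/-- `G t`, `t ∈ ℕ`, is a random increasing sequence of spanning subgraphs of `Gbar`, adapted to
`𝓕` and started at the given graph `G0`, which grows by touch of the adapted sequence `Y t` of
sites: it can change between times `t` and `t + 1` only when `Y t` is in the boundary of `G t`, and
then the added edges lie in the closed unit ball of `Gbar` around `Y t`. -/
structure IsTouchGrowth (Gbar G0 : SimpleGraph V) (μ : Measure Ω)
    (𝓕 : Filtration ℕ mΩ)
    (G : ℕ → Ω → SimpleGraph V) (Y : ℕ → Ω → V) : Prop where
  adapted_graph : ∀ t x y, MeasurableSet[𝓕 t] {ω | (G t ω).Adj x y}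
  adapted_walk : ∀ t, Measurable[𝓕 t] (Y t)
  start : ∀ᵐ ω ∂μ, G 0 ω = G0
  le_ambient : ∀ t, ∀ᵐ ω ∂μ, G t ω ≤ Gbar
  mono : ∀ t, ∀ᵐ ω ∂μ, G t ω ≤ G (t + 1) ω
  eq_of_notMem : ∀ t, ∀ᵐ ω ∂μ, Y t ω ∉ boundary Gbar (G t ω) → G (t + 1) ω = G t ω
  added_near : ∀ t, ∀ᵐ ω ∂μ, ∀ a b, (G (t + 1) ω).Adj a b → ¬ (G t ω).Adj a b →
    a ∈ ball Gbar (Y t ω) 1 ∧ b ∈ ball Gbar (Y t ω) 1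

/-- Open by touch interaction: whenever `Y t` is in the boundary of `G t`, all edges of `Gbar` at
`Y t` are opened. By `added_near` the other edges of the closed unit ball, which join two
neighbours of `Y t`, may or may not be opened as well, so that both the rule 'add the edges at
`Y t`' and the rule 'add all edges of the subgraph induced on the ball' are instances. -/
structure IsOBT (Gbar G0 : SimpleGraph V) (μ : Measure Ω)
    (𝓕 : Filtration ℕ mΩ)
    (G : ℕ → Ω → SimpleGraph V) (Y : ℕ → Ω → V) : Prop
    extends IsTouchGrowth Gbar G0 μ 𝓕 G Y where
  opens : ∀ t, ∀ᵐ ω ∂μ, Y t ω ∈ boundary Gbar (G t ω) →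
    ∀ y, Gbar.Adj (Y t ω) y → (G (t + 1) ω).Adj (Y t ω) y

/-- Partially open by touch interaction: there is `ε > 0` such that whenever `Y t` is in the
boundary of `G t`, given the past at least one new edge at `Y t` is opened with probability at
least `ε`. -/
structure IsPOBT (Gbar G0 : SimpleGraph V) (μ : Measure Ω)
    (𝓕 : Filtration ℕ mΩ)
    (G : ℕ → Ω → SimpleGraph V) (Y : ℕ → Ω → V) : Prop
    extends IsTouchGrowth Gbar G0 μ 𝓕 G Y where
  opens_with_prob : ∃ ε > (0 : ℝ), ∀ t, ∀ᵐ ω ∂μ, Y t ω ∈ boundary Gbar (G t ω) →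
    ε ≤ (μ⟦{ω' | ∃ y, (G (t + 1) ω').Adj (Y t ω') y ∧ ¬ (G t ω').Adj (Y t ω') y} | 𝓕 t⟧) ω

/-- `Y` moves as an extended simple random walk started at `o`: given the past it makes a step of
simple random walk on `Gbar` when it is off the boundary of the current graph, while from a
boundary site `x` it may move in any (random, history-dependent) way inside the ball of
radius `r x` around `x`. -/
structure IsExtendedSRW (Gbar : SimpleGraph V) (o : V) (r : V → ℝ) (μ : Measure Ω)
    (𝓕 : Filtration ℕ mΩ)
    (G : ℕ → Ω → SimpleGraph V) (Y : ℕ → Ω → V) : Prop where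
  start : ∀ᵐ ω ∂μ, Y 0 ω = o
  step : ∀ t y, ∀ᵐ ω ∂μ, Y t ω ∉ boundary Gbar (G t ω) →
    (μ⟦{ω' | Y (t + 1) ω' = y} | 𝓕 t⟧) ω = (srwKernel Gbar (Y t ω)).real {y}
  jump : ∀ t, ∀ᵐ ω ∂μ, Y t ω ∈ boundary Gbar (G t ω) →
    Y (t + 1) ω ∈ ball Gbar (Y t ω) (r (Y t ω))

end Model

/-- The sample path `Y` is almost surely transient: almost surely every vertex is visited only
finitely often. -/
def AlmostSurelyTransient {V Ω : Type*} [MeasurableSpace Ω] (μ : Measure Ω)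
    (Y : ℕ → Ω → V) : Prop :=
  ∀ᵐ ω ∂μ, ∀ x, {t | Y t ω = x}.Finite

/-! ### The integer lattice -/

/-- The nearest-neighbour graph on `ℤ^d`. -/
def latticeGraph (d : ℕ) : SimpleGraph (Fin d → ℤ) where
  Adj x y := ∑ i, |x i - y i| = 1
  symm := ⟨fun x y h => by simpa only [abs_sub_comm] using h⟩
  loopless := ⟨fun x h => by simp at h⟩

/-- Lattice points on the boundary of the box `[-k/2, k/2]^d` of side length `k`. -/
def boxBoundary (d k : ℕ) : Set (Fin d → ℤ) :=
  {x | (∀ i, 2 * |x i| ≤ k) ∧ ∃ i, 2 * |x i| = k}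

/-- `N(k)`: the number of boundary sites of `D0` on the boundary of the box of side length `k`
centred at the origin. -/
def boxCount (d : ℕ) (D0 : SimpleGraph (Fin d → ℤ)) (k : ℕ) : ℕ :=
  (boundary (latticeGraph d) D0 ∩ boxBoundary d k).ncard

end GrowingWalk

end

open GrowingWalk

/-!
Let `u` be the probability that simple random walk ever hits `o`. It is harmonic off `o`, and
transience makes its mean over one step from `o` at most `1 - δ` for some `δ > 0`. Along the
extended walk `Y`, the mean of `u (Y t)` drops by at least `δ` times the probability that `Y` is at
`o` and off the boundary, while a jump from a boundary site `x` raises `u` by at most its supremum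
over the ball `C(x)`. Touching bounds the expected number of boundary visits to any `x` by a
constant `K`: there is at most one visit if all edges are opened, and at most `D / ε` in the mean if
each visit opens one of at most `D` edges with probability at least `ε`. Summing over `t`, the
expected number of visits to `o` is finite because `1 + K S⋆` is. Every other site is joined to `o`
by a path, and a site visited infinitely often would pass this on to each of its neighbours.

On `ℤ^d`, `(|x|² + a) ^ (-(d - 2) / 2)` is superharmonic for large `a`, and strictly so at `0`.
Comparison with it shows that the return probability is less than one and that `u y` is at most of
order `|y| ^ (2 - d)`. Since a jump from `x` ends at distance at least `(1 - c) |x| - 1` from `0`,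
a multiple of `∑ N(k) k ^ (2 - d)` bounds `S⋆`, up to the contribution of the origin.
-/

noncomputable section

namespace GrowingWalk

section PathSpace

open Preorder

variable {V : Type*} [MeasurableSpace V]

/-- `ν` is the law on path space of a time-homogeneous Markov chain with transition kernel `κ` (and
arbitrary initial law): the law of the path up to time `n + 1` is obtained from that of the path
up to time `n` by one step of `κ` from its last position. -/
def IsChainLaw (κ : Kernel V V) (ν : Measure (ℕ → V)) : Prop :=
  ∀ n, ν.map (fun w => (frestrictLe (π := fun _ => V) n w, w (n + 1))) =
    ν.map (frestrictLe (π := fun _ => V) n) ⊗ₘ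
      κ.comap (fun h => h ⟨n, Finset.mem_Iic.mpr le_rfl⟩) (measurable_pi_apply _)

lemma measure_eq_of_map_frestrictLe_eq {ν₁ ν₂ : Measure (ℕ → V)} [IsFiniteMeasure ν₂]
    (h : ∀ n, ν₁.map (frestrictLe (π := fun _ => V) n) = ν₂.map (frestrictLe (π := fun _ => V) n)) :
    ν₁ = ν₂ := by
  refine IsProjectiveLimit.unique (P := fun I : Finset ℕ => ν₂.map I.restrict) (fun I => ?_)
    fun _ => rfl
  have hmeas := Finset.measurable_restrict₂ (X := fun _ : ℕ => V) I.subset_Iic_sup_id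
  simp only [← Finset.restrict₂_comp_restrict (π := fun _ : ℕ => V) I.subset_Iic_sup_id]
  rw [← Measure.map_map hmeas (by fun_prop), ← frestrictLe, h,
    Measure.map_map hmeas (by fun_prop), frestrictLe]

lemma map_prodMap_compProd_comap {α β γ : Type*} [MeasurableSpace α] [MeasurableSpace β]
    [MeasurableSpace γ] {μ : Measure α} [SFinite μ] {κ : Kernel β γ} [IsSFiniteKernel κ]
    {g : α → β} (hg : Measurable g) :
    (μ ⊗ₘ κ.comap g hg).map (Prod.map g id) = μ.map g ⊗ₘ κ := by
  ext s hs
  rw [Measure.map_apply (by fun_prop) hs, Measure.compProd_apply (by measurability),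
    Measure.compProd_apply hs, lintegral_map (Kernel.measurable_kernel_prodMk_left hs) hg]
  rfl

namespace IsChainLaw

variable {κ : Kernel V V} {ν ν₁ ν₂ : Measure (ℕ → V)}

lemma ext [IsFiniteMeasure ν₂] (h₁ : IsChainLaw κ ν₁) (h₂ : IsChainLaw κ ν₂)
    (h₀ : ν₁.map (fun w => w 0) = ν₂.map (fun w => w 0)) : ν₁ = ν₂ := by
  refine measure_eq_of_map_frestrictLe_eq fun n => ?_
  induction n with
  | zero =>
    have hconst : frestrictLe (π := fun _ : ℕ => V) 0 = (fun v _ => v) ∘ fun w => w 0 := by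
      ext w ⟨i, hi⟩
      obtain rfl : i = 0 := by simpa using hi
      rfl
    rw [hconst, ← Measure.map_map (by fun_prop) (by fun_prop), h₀,
      Measure.map_map (by fun_prop) (by fun_prop)]
  | succ n ih =>
    let snoc : (Finset.Iic n → V) × V → (Finset.Iic (n + 1) → V) := fun p i =>
      if h : i.1 ≤ n then p.1 ⟨i, Finset.mem_Iic.2 h⟩ else p.2
    have hsnoc : Measurable snoc := by
      refine measurable_pi_lambda _ fun i => ?_
      by_cases h : i.1 ≤ n <;> simp only [snoc, h, dite_true, dite_false] <;> fun_prop
    have hcomp : frestrictLe (π := fun _ : ℕ => V) (n + 1) =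
        snoc ∘ fun w => (frestrictLe n w, w (n + 1)) := by
      ext w ⟨i, hi⟩
      rcases Nat.le_succ_iff.1 (Finset.mem_Iic.1 hi) with h | rfl
      · simp [snoc, h]
      · simp [snoc]
    rw [hcomp, ← Measure.map_map hsnoc (by fun_prop), h₁, ih, ← h₂,
      Measure.map_map hsnoc (by fun_prop)]

lemma map_one [IsFiniteMeasure ν] [IsSFiniteKernel κ] (hν : IsChainLaw κ ν) :
    ν.map (fun w => w 1) = κ ∘ₘ ν.map (fun w => w 0) := by
  have hsnd : ν.map (fun w => w 1) =
      (ν.map fun w => (frestrictLe (π := fun _ => V) 0 w, w 1)).snd := by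
    rw [Measure.snd_map_prodMk (by fun_prop)]
  rw [hsnd, hν 0, Measure.snd_compProd]
  ext s hs
  rw [Measure.bind_apply hs (Kernel.aemeasurable _), Measure.bind_apply hs (Kernel.aemeasurable _),
    lintegral_map (Kernel.measurable_coe _ hs) (by fun_prop),
    lintegral_map (Kernel.measurable_coe _ hs) (by fun_prop)]
  rfl

lemma map_tail [IsFiniteMeasure ν] [IsSFiniteKernel κ] (hν : IsChainLaw κ ν) :
    IsChainLaw κ (ν.map fun w n => w (n + 1)) := by
  intro n
  let tail : (Finset.Iic (n + 1) → V) → (Finset.Iic n → V) := fun h i =>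
    h ⟨i + 1, Finset.mem_Iic.2 (Nat.succ_le_succ (Finset.mem_Iic.1 i.2))⟩
  have htail : Measurable tail := by fun_prop
  rw [Measure.map_map (by fun_prop) (by fun_prop), Measure.map_map (by fun_prop) (by fun_prop)]
  have := congrArg (Measure.map (Prod.map tail id)) (hν (n + 1))
  rw [Measure.map_map (by fun_prop) (by fun_prop)] at this
  refine this.trans ?_
  refine (map_prodMap_compProd_comap (κ := κ.comap
    (fun h : Finset.Iic n → V => h ⟨n, Finset.mem_Iic.mpr le_rfl⟩) (measurable_pi_apply _))
    htail).trans ?_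
  rw [Measure.map_map htail (by fun_prop)]
  rfl

end IsChainLaw

end PathSpace

section SimpleRandomWalk

open Preorder

variable {V : Type*} [MeasurableSpace V] {G : SimpleGraph V} {o : V} {f g : V → ℝ≥0∞}

/-- The one-step average of a function under simple random walk. -/
def stepMean (G : SimpleGraph V) (f : V → ℝ≥0∞) (y : V) : ℝ≥0∞ := ∫⁻ z, f z ∂(srwStep G y)

lemma stepMean_mono (h : ∀ y, f y ≤ g y) (y : V) : stepMean G f y ≤ stepMean G g y :=
  lintegral_mono h

variable [DiscreteMeasurableSpace V]

lemma stepMean_const (c : ℝ≥0∞) (y : V) : stepMean G (fun _ => c) y = c := by simp [stepMean]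

lemma isChainLaw_trajMeasure (μ : Measure V) [IsProbabilityMeasure μ] :
    IsChainLaw (srwKernel G) (Kernel.trajMeasure (X := fun _ => V) μ (srwHistoryKernel G)) :=
  fun _ => Kernel.map_frestrictLe_trajMeasure_compProd_eq_map_trajMeasure.symm

lemma isChainLaw_srwLaw (y : V) : IsChainLaw (srwKernel G) (srwLaw G y) :=
  isChainLaw_trajMeasure _

instance (y : V) : IsProbabilityMeasure (srwLaw G y) :=
  inferInstanceAs (IsProbabilityMeasure (Kernel.trajMeasure (X := fun _ => V) _ _))

lemma map_zero_trajMeasure (μ : Measure V) [IsProbabilityMeasure μ] :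
    (Kernel.trajMeasure (X := fun _ => V) μ (srwHistoryKernel G)).map (fun w => w 0) = μ := by
  have hproj : (fun w : ℕ → V => w 0) =
      (fun h : Finset.Iic 0 → V => h ⟨0, by simp⟩) ∘ frestrictLe (π := fun _ => V) 0 := rfl
  rw [hproj, ← Measure.map_map (by fun_prop) (by fun_prop), Kernel.trajMeasure,
    Measure.map_comp _ _ (by fun_prop), Kernel.traj_map_frestrictLe, Kernel.partialTraj_self,
    Measure.id_comp, Measure.map_map (by fun_prop) (by fun_prop)]
  exact Measure.map_id

lemma trajMeasure_eq_bind_srwLaw (μ : Measure V) :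
    Kernel.trajMeasure (X := fun _ => V) μ (srwHistoryKernel G) = μ.bind (srwLaw G) := by
  let e := (MeasurableEquiv.piUnique fun _ : Finset.Iic (0 : ℕ) => V).symm
  have hlaw (z : V) : srwLaw G z = Kernel.traj (X := fun _ => V) (srwHistoryKernel G) 0 (e z) := by
    refine (congrArg (Measure.bind · _) (Measure.map_dirac' e.measurable z)).trans ?_
    exact Measure.dirac_bind (Kernel.measurable _) _
  ext s hs
  rw [Measure.bind_apply hs (by fun_prop), Kernel.trajMeasure, Measure.bind_apply hs (by fun_prop),
    lintegral_map (Kernel.measurable_coe _ hs) e.measurable]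
  simp only [hlaw, e]

lemma map_tail_srwLaw (y : V) :
    (srwLaw G y).map (fun w n => w (n + 1)) = (srwStep G y).bind (srwLaw G) := by
  rw [← trajMeasure_eq_bind_srwLaw]
  refine (isChainLaw_srwLaw y).map_tail.ext (isChainLaw_trajMeasure _) ?_
  rw [Measure.map_map (by fun_prop) (by fun_prop), map_zero_trajMeasure]
  refine (isChainLaw_srwLaw y).map_one.trans ?_
  rw [srwLaw, map_zero_trajMeasure, Measure.dirac_bind (Kernel.measurable _)]
  rfl

lemma srwLaw_ae_start (y : V) : ∀ᵐ w ∂(srwLaw G y), w 0 = y := by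
  have hmeas : Measurable fun w : ℕ → V => w 0 := by fun_prop
  refine ae_of_ae_map hmeas.aemeasurable (p := fun z => z = y) ?_
  rw [srwLaw, map_zero_trajMeasure, ae_dirac_eq]
  exact Filter.eventually_pure.2 rfl

lemma srwLaw_tail (y : V) {A : Set (ℕ → V)} (hA : MeasurableSet A) :
    srwLaw G y {w | (fun n => w (n + 1)) ∈ A} = stepMean G (fun z => srwLaw G z A) y := by
  rw [stepMean, ← Measure.bind_apply hA (by fun_prop), ← map_tail_srwLaw,
    Measure.map_apply (by fun_prop) hA]
  rfl

lemma stepMean_mul_const (f : V → ℝ≥0∞) (c : ℝ≥0∞) (y : V) :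
    stepMean G (fun z => f z * c) y = stepMean G f y * c :=
  lintegral_mul_const c Measurable.of_discrete

/-- The probability that simple random walk started at `y` visits `o` at some time in `I`. -/
def visitProb (G : SimpleGraph V) (o : V) (I : Set ℕ) (y : V) : ℝ≥0∞ :=
  srwLaw G y {w | ∃ k ∈ I, w k = o}

lemma visitProb_univ : visitProb G o Set.univ = hitProb G o := by
  ext y
  simp [visitProb, hitProb]

lemma visitProb_le_one (I : Set ℕ) (y : V) : visitProb G o I y ≤ 1 := prob_le_one

lemma visitProb_self {I : Set ℕ} (hI : 0 ∈ I) : visitProb G o I o = 1 := by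
  refine (measure_congr (Filter.eventuallyEq_univ.2 ?_)).trans measure_univ
  filter_upwards [srwLaw_ae_start o] with w hw using ⟨0, hI, hw⟩

lemma measurableSet_exists_visit (o : V) (I : Set ℕ) :
    MeasurableSet {w : ℕ → V | ∃ k ∈ I, w k = o} := by
  have : {w : ℕ → V | ∃ k ∈ I, w k = o} = ⋃ k ∈ I, (fun w => w k) ⁻¹' {o} := by
    ext w; simp
  rw [this]
  exact .biUnion I.to_countable fun k _ => measurable_pi_apply k (measurableSet_singleton o)

lemma visitProb_eq_stepMean {I : Set ℕ} {y : V} (h : 0 ∈ I → y ≠ o) :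
    visitProb G o I y = stepMean G (visitProb G o {k | k + 1 ∈ I}) y := by
  refine (measure_congr ?_).trans (srwLaw_tail y (measurableSet_exists_visit o {k | k + 1 ∈ I}))
  filter_upwards [srwLaw_ae_start y] with w hw
  refine propext ⟨?_, fun ⟨n, hn, hwn⟩ => ⟨n + 1, hn, hwn⟩⟩
  rintro ⟨_ | n, hn, hwn⟩
  · exact absurd (hw.symm.trans hwn) (h hn)
  · exact ⟨n, hn, hwn⟩

lemma hitProb_self : hitProb G o o = 1 := by
  rw [← visitProb_univ, visitProb_self (Set.mem_univ 0)]

lemma hitProb_le_one (y : V) : hitProb G o y ≤ 1 := prob_le_one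

lemma hitProb_of_ne {y : V} (hy : y ≠ o) : hitProb G o y = stepMean G (hitProb G o) y := by
  rw [← visitProb_univ, visitProb_eq_stepMean fun _ => hy]
  rfl

lemma stepMean_hitProb_le (y : V) : stepMean G (hitProb G o) y ≤ hitProb G o y := by
  rcases eq_or_ne y o with rfl | hy
  · rw [hitProb_self]
    exact (stepMean_mono hitProb_le_one y).trans_eq (stepMean_const 1 y)
  · exact (hitProb_of_ne hy).ge

lemma stepMean_hitProb_add_indicator (hret : stepMean G (hitProb G o) o < 1) (y : V) :
    stepMean G (hitProb G o) y +
      ({o} : Set V).indicator (fun _ => 1 - stepMean G (hitProb G o) o) y = hitProb G o y := by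
  rcases eq_or_ne y o with rfl | hy
  · rw [Set.indicator_of_mem (Set.mem_singleton _), add_tsub_cancel_of_le hret.le, hitProb_self]
  · rw [Set.indicator_of_notMem (by simpa using hy), add_zero, ← hitProb_of_ne hy]

lemma visitProb_Iic_mul_le_of_superharmonic (hf : ∀ y, stepMean G f y ≤ f y) (n : ℕ) (y : V) :
    visitProb G o (Set.Iic n) y * f o ≤ f y := by
  induction n generalizing y with
  | zero =>
    rcases eq_or_ne y o with rfl | hy
    · exact mul_le_of_le_one_left' (visitProb_le_one _ _)
    · have : {k | k + 1 ∈ Set.Iic 0} = (∅ : Set ℕ) := by ext k; simp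
      rw [visitProb_eq_stepMean fun _ => hy, this]
      simp [visitProb, stepMean]
  | succ n ih =>
    rcases eq_or_ne y o with rfl | hy
    · exact mul_le_of_le_one_left' (visitProb_le_one _ _)
    · have : {k | k + 1 ∈ Set.Iic (n + 1)} = Set.Iic n := by ext k; simp
      rw [visitProb_eq_stepMean fun _ => hy, this, ← stepMean_mul_const]
      exact (stepMean_mono ih y).trans (hf y)

lemma hitProb_mul_le_of_superharmonic (hf : ∀ y, stepMean G f y ≤ f y) (y : V) :
    hitProb G o y * f o ≤ f y := by
  have hiUnion : {w : ℕ → V | ∃ n, w n = o} = ⋃ n, {w | ∃ k ∈ Set.Iic n, w k = o} := by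
    ext w
    simp only [Set.mem_ofPred_eq, Set.mem_iUnion]
    exact ⟨fun ⟨n, hn⟩ => ⟨n, n, Set.mem_Iic.2 le_rfl, hn⟩, fun ⟨_, k, _, hk⟩ => ⟨k, hk⟩⟩
  rw [hitProb, hiUnion, Monotone.measure_iUnion, ENNReal.iSup_mul]
  · exact iSup_le fun n => visitProb_Iic_mul_le_of_superharmonic hf n y
  · exact fun m n hmn w ⟨k, hk, hw⟩ => ⟨k, le_trans hk hmn, hw⟩

lemma stepMean_hitProb_self_lt_one_of_superharmonic (hf : ∀ y, stepMean G f y ≤ f y)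
    (ho : stepMean G f o < f o) : stepMean G (hitProb G o) o < 1 := by
  by_contra! h
  refine ho.not_ge ?_
  calc f o ≤ stepMean G (hitProb G o) o * f o := le_mul_of_one_le_left' h
    _ = stepMean G (fun z => hitProb G o z * f o) o := (stepMean_mul_const _ _ _).symm
    _ ≤ stepMean G f o := stepMean_mono (hitProb_mul_le_of_superharmonic hf) o

lemma srwStep_singleton_ne_zero {y z : V} (hfin : (G.neighborSet y).Finite) (hyz : G.Adj y z) :
    srwStep G y {z} ≠ 0 := by
  rw [srwStep, if_pos ⟨hfin, z, hyz⟩, ne_eq, uniformOn_eq_zero_iff hfin]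
  exact Set.Nonempty.ne_empty ⟨z, hyz, rfl⟩

lemma eq_one_of_stepMean_eq_one (hf : ∀ y, f y ≤ 1) {y z : V}
    (hfin : (G.neighborSet y).Finite) (hyz : G.Adj y z) (h : stepMean G f y = 1) : f z = 1 := by
  have hae : f =ᵐ[srwStep G y] fun _ => 1 :=
    ae_eq_of_ae_le_of_lintegral_le (ae_of_all _ hf) (ne_of_eq_of_ne h ENNReal.one_ne_top)
      aemeasurable_const (by simpa [stepMean] using h.ge)
  by_contra hz
  exact srwStep_singleton_ne_zero hfin hyz (measure_mono_null (by simpa using hz) hae)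

lemma hitProb_eq_one_of_stepMean_self_eq_one (hconn : G.Connected)
    (hfin : ∀ x, (G.neighborSet x).Finite) (h : stepMean G (hitProb G o) o = 1) (y : V) :
    hitProb G o y = 1 := by
  have hreach := (SimpleGraph.reachable_iff_reflTransGen o y).1 (hconn.preconnected o y)
  induction hreach with
  | refl => exact hitProb_self
  | @tail y z _ hyz ih =>
    refine eq_one_of_stepMean_eq_one hitProb_le_one (hfin y) hyz ?_
    rcases eq_or_ne y o with rfl | hy
    · exact h
    · rw [← hitProb_of_ne hy, ih]

lemma stepMean_hitProb_self_lt_one (hconn : G.Connected) (hfin : ∀ x, (G.neighborSet x).Finite)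
    (htr : SRWTransient G o) : stepMean G (hitProb G o) o < 1 := by
  refine lt_of_le_of_ne ((stepMean_hitProb_le o).trans_eq hitProb_self) fun hone => ?_
  have hlate (n : ℕ) : visitProb G o (Set.Ici n) = fun _ => 1 := by
    induction n with
    | zero =>
      ext y
      rw [← hitProb_eq_one_of_stepMean_self_eq_one hconn hfin hone y, ← visitProb_univ]
      congr
      simp
    | succ n ih =>
      ext y
      have : {k | k + 1 ∈ Set.Ici (n + 1)} = Set.Ici n := by ext k; simp
      rw [visitProb_eq_stepMean (by simp), this, ih, stepMean_const]
  have hio : ∀ᵐ w ∂(srwLaw G o), ∀ n, ∃ k ∈ Set.Ici n, w k = o :=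
    ae_all_iff.2 fun n => (mem_ae_iff_prob_eq_one (measurableSet_exists_visit o _)).2
      (congrFun (hlate n) o)
  obtain ⟨w, hw, hw'⟩ := (htr.and hio).exists
  obtain ⟨b, hb⟩ := hw.bddAbove
  obtain ⟨k, hk, hwk⟩ := hw' (b + 1)
  exact Nat.not_succ_le_self b (le_trans hk (hb hwk))

end SimpleRandomWalk
section Growth

open Filter

lemma countable_of_connected {V : Type*} {G : SimpleGraph V} (hconn : G.Connected)
    (hcount : ∀ x, (G.neighborSet x).Countable) : Countable V := by
  obtain ⟨o⟩ := hconn.nonempty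
  have hlength (n : ℕ) : {y | ∃ p : G.Walk y o, p.length = n}.Countable := by
    induction n with
    | zero =>
      refine (Set.countable_singleton o).mono ?_
      rintro y ⟨p, hp⟩
      exact p.eq_of_length_eq_zero hp
    | succ n ih =>
      refine (ih.biUnion fun y _ => hcount y).mono ?_
      rintro z ⟨_ | ⟨hzy, q⟩, hp⟩
      · simp at hp
      · exact Set.mem_biUnion ⟨q, by simpa using hp⟩ hzy.symm
  refine Set.countable_univ_iff.mp ((Set.countable_iUnion hlength).mono fun y _ => ?_)
  obtain ⟨p⟩ := hconn.preconnected y o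
  exact Set.mem_iUnion.mpr ⟨p.length, p, rfl⟩

lemma mem_boundary_iff {V : Type*} {Gbar H : SimpleGraph V} {x : V} (hle : H ≤ Gbar)
    (hfin : (Gbar.neighborSet x).Finite) :
    x ∈ boundary Gbar H ↔ ∃ y, Gbar.Adj x y ∧ ¬ H.Adj x y := by
  constructor
  · intro hx
    by_contra! hcon
    have hsub : Gbar.neighborSet x ⊆ H.neighborSet x := fun y hy => hcon y hy
    exact hx.not_ge (Set.ncard_le_ncard hsub (hfin.subset fun y hy => hle hy))
  · rintro ⟨y, hy, hy'⟩
    exact Set.ncard_lt_ncard ⟨fun z hz => hle hz, fun h => hy' (h hy)⟩ hfin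

lemma tsum_le_of_add_le_add {a b p : ℕ → ℝ≥0∞} (h : ∀ n, a (n + 1) + p n ≤ a n + b n) :
    ∑' n, p n ≤ a 0 + ∑' n, b n := by
  have hpartial (n : ℕ) :
      a n + ∑ i ∈ Finset.range n, p i ≤ a 0 + ∑ i ∈ Finset.range n, b i := by
    induction n with
    | zero => simp
    | succ n ih =>
      rw [Finset.sum_range_succ, Finset.sum_range_succ]
      calc a (n + 1) + (∑ i ∈ Finset.range n, p i + p n)
          = a (n + 1) + p n + ∑ i ∈ Finset.range n, p i := by ring
        _ ≤ a n + b n + ∑ i ∈ Finset.range n, p i := add_le_add (h n) le_rfl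
        _ = a n + ∑ i ∈ Finset.range n, p i + b n := by ring
        _ ≤ a 0 + ∑ i ∈ Finset.range n, b i + b n := by gcongr
        _ = a 0 + (∑ i ∈ Finset.range n, b i + b n) := by ring
  refine ENNReal.tsum_le_of_sum_range_le fun n => ?_
  exact (le_add_self.trans (hpartial n)).trans (by gcongr; exact ENNReal.sum_le_tsum _)

section ConditionalProbability

variable {Ω : Type*} {m mΩ : MeasurableSpace Ω} {μ : Measure Ω} [IsFiniteMeasure μ] {A B : Set Ω}

lemma setLIntegral_ofReal_condProb (hm : m ≤ mΩ) (hA : MeasurableSet[m] A)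
    (hB : MeasurableSet B) : ∫⁻ ω in A, ENNReal.ofReal ((μ⟦B | m⟧) ω) ∂μ = μ (A ∩ B) := by
  have hnonneg : 0 ≤ᵐ[μ.restrict A] μ⟦B | m⟧ :=
    ae_restrict_of_ae (condExp_nonneg (ae_of_all _ fun ω => Set.indicator_nonneg (by simp) ω))
  rw [← ofReal_integral_eq_lintegral_ofReal integrable_condExp.integrableOn hnonneg,
    setIntegral_condExp hm ((integrable_const 1).indicator hB) hA, setIntegral_indicator hB]
  simp

lemma ofReal_mul_measure_le_measure_inter (hm : m ≤ mΩ) (hA : MeasurableSet[m] A)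
    (hB : MeasurableSet B) {ε : ℝ} (h : ∀ᵐ ω ∂μ, ω ∈ A → ε ≤ (μ⟦B | m⟧) ω) :
    ENNReal.ofReal ε * μ A ≤ μ (A ∩ B) := by
  rw [← setLIntegral_const, ← setLIntegral_ofReal_condProb hm hA hB]
  refine setLIntegral_mono_ae' (hm _ hA) ?_
  filter_upwards [h] with ω hω hωA using ENNReal.ofReal_le_ofReal (hω hωA)

lemma setLIntegral_comp_of_condProb_eq {V : Type*} [Countable V] [MeasurableSpace V]
    [MeasurableSingletonClass V] {X : Ω → V} (hX : Measurable X) {κ : Kernel Ω V}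
    [IsFiniteKernel κ] (hm : m ≤ mΩ) (hA : MeasurableSet[m] A)
    (h : ∀ y, ∀ᵐ ω ∂μ, ω ∈ A → (μ⟦{ω' | X ω' = y} | m⟧) ω = (κ ω).real {y}) (f : V → ℝ≥0∞) :
    ∫⁻ ω in A, f (X ω) ∂μ = ∫⁻ ω in A, ∫⁻ y, f y ∂κ ω ∂μ := by
  have hlaw : (μ.restrict A).map X = (μ.restrict A).bind κ := by
    refine Measure.ext_of_singleton fun y => ?_
    have hy := hX (measurableSet_singleton y)
    rw [Measure.map_apply hX (measurableSet_singleton y), Measure.restrict_apply hy,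
      Set.inter_comm, ← setLIntegral_ofReal_condProb hm hA hy,
      Measure.bind_apply (measurableSet_singleton y) κ.aemeasurable]
    refine setLIntegral_congr_fun_ae (hm _ hA) ?_
    filter_upwards [h y] with ω hω hωA
    rw [← ofReal_measureReal (s := {y}), ← hω hωA]
    rfl
  have hf : Measurable f := measurable_of_countable f
  rw [← lintegral_map hf hX, hlaw, Measure.lintegral_bind κ.aemeasurable hf.aemeasurable]

end ConditionalProbability

lemma tsum_measure_le_of_strictly_increasing_on {Ω : Type*} {mΩ : MeasurableSpace Ω} {μ : Measure Ω}
    {A : ℕ → Set Ω} (hA : ∀ t, MeasurableSet (A t)) {φ : ℕ → Ω → ℕ} {K : ℕ}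
    (hK : ∀ᵐ ω ∂μ, ∀ t, φ t ω ≤ K) (hmono : ∀ᵐ ω ∂μ, ∀ t, φ t ω ≤ φ (t + 1) ω)
    (hlt : ∀ᵐ ω ∂μ, ∀ t, ω ∈ A t → φ t ω < φ (t + 1) ω) :
    ∑' t, μ (A t) ≤ K * μ Set.univ := by
  have hcount : ∀ᵐ ω ∂μ, ∑' t, (A t).indicator (1 : Ω → ℝ≥0∞) ω ≤ K := by
    filter_upwards [hK, hmono, hlt] with ω hK hmono hlt
    have hstep (t : ℕ) : ((K - φ (t + 1) ω : ℕ) : ℝ≥0∞) + (A t).indicator 1 ω ≤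
        (K - φ t ω : ℕ) + 0 := by
      by_cases hω : ω ∈ A t
      · rw [Set.indicator_of_mem hω, Pi.one_apply]
        have := hlt t hω
        have := hK (t + 1)
        exact_mod_cast (by omega : K - φ (t + 1) ω + 1 ≤ K - φ t ω + 0)
      · rw [Set.indicator_of_notMem hω]
        have := hmono t
        exact_mod_cast (by omega : K - φ (t + 1) ω + 0 ≤ K - φ t ω + 0)
    refine (tsum_le_of_add_le_add hstep).trans ?_
    rw [tsum_zero, add_zero]
    exact_mod_cast Nat.sub_le _ _
  calc ∑' t, μ (A t) = ∫⁻ ω, ∑' t, (A t).indicator 1 ω ∂μ := by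
        rw [lintegral_tsum fun t => (measurable_one.indicator (hA t)).aemeasurable]
        simp only [lintegral_indicator_one (hA _)]
    _ ≤ ∫⁻ _, K ∂μ := lintegral_mono_ae hcount
    _ = K * μ Set.univ := lintegral_const _

variable {V Ω : Type*} [MeasurableSpace V] {mΩ : MeasurableSpace Ω} {Gbar G0 : SimpleGraph V}
  {o : V} {r : V → ℝ} {μ : Measure Ω} {𝓕 : Filtration ℕ mΩ} {G : ℕ → Ω → SimpleGraph V}
  {Y : ℕ → Ω → V}

/-- The event `{Y t = x, x ∈ ∂(G t)}`, with the boundary described through the missing edges at `x`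
rather than through degrees. For `G t ≤ Gbar` the two agree by `mem_boundary_iff`; the present form
is measurable without further assumptions. -/
def boundaryVisit (Gbar : SimpleGraph V) (G : ℕ → Ω → SimpleGraph V) (Y : ℕ → Ω → V) (t : ℕ)
    (x : V) : Set Ω :=
  {ω | Y t ω = x ∧ ∃ y, Gbar.Adj x y ∧ ¬ (G t ω).Adj x y}

/-- The event that at time `t` an edge at the current site is opened, as in `IsPOBT`. -/
def opening (G : ℕ → Ω → SimpleGraph V) (Y : ℕ → Ω → V) (t : ℕ) : Set Ω :=
  {ω | ∃ y, (G (t + 1) ω).Adj (Y t ω) y ∧ ¬ (G t ω).Adj (Y t ω) y}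

namespace IsTouchGrowth

variable (hg : IsTouchGrowth Gbar G0 μ 𝓕 G Y)
include hg

lemma ae_monotone : ∀ᵐ ω ∂μ, Monotone fun t => G t ω := by
  filter_upwards [ae_all_iff.mpr hg.mono] with ω hω using monotone_nat_of_le_succ hω

lemma ae_mem_boundary_iff (hfin : ∀ x, (Gbar.neighborSet x).Finite) : ∀ᵐ ω ∂μ, ∀ t,
    Y t ω ∈ boundary Gbar (G t ω) ↔ ω ∈ boundaryVisit Gbar G Y t (Y t ω) := by
  filter_upwards [ae_all_iff.mpr hg.le_ambient] with ω hω t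
  simp [mem_boundary_iff (hω t) (hfin _), boundaryVisit]

lemma measure_boundaryVisit_eq_zero (hfin : ∀ x, (Gbar.neighborSet x).Finite) (t : ℕ) {x : V}
    (hx : x ∉ boundary Gbar G0) : μ (boundaryVisit Gbar G Y t x) = 0 := by
  refine measure_eq_zero_iff_ae_notMem.2 ?_
  filter_upwards [hg.start, hg.le_ambient 0, hg.ae_monotone] with ω hstart hle hmono
  rintro ⟨-, y, hxy, hy⟩
  rw [hstart] at hle
  exact hx ((mem_boundary_iff hle (hfin x)).2 ⟨y, hxy, fun h => hy (hmono t.zero_le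
    (show (G 0 ω).Adj x y from hstart ▸ h))⟩)

end IsTouchGrowth

lemma IsTouchGrowth.tsum_mul_measure_boundaryVisit_le (hg : IsTouchGrowth Gbar G0 μ 𝓕 G Y)
    (hfin : ∀ x, (Gbar.neighborSet x).Finite) {K : ℝ≥0∞}
    (hbv : ∀ x, ∑' t, μ (boundaryVisit Gbar G Y t x) ≤ K) (g : V → ℝ≥0∞) :
    ∑' t, ∑' x, g x * μ (boundaryVisit Gbar G Y t x) ≤ (∑' x : boundary Gbar G0, g x) * K := by
  rw [ENNReal.tsum_comm, tsum_subtype (boundary Gbar G0) g, ← ENNReal.tsum_mul_right]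
  refine ENNReal.tsum_le_tsum fun x => ?_
  by_cases hx : x ∈ boundary Gbar G0
  · rw [ENNReal.tsum_mul_left, Set.indicator_of_mem hx]
    gcongr
    exact hbv x
  · simp [hg.measure_boundaryVisit_eq_zero hfin _ hx]

lemma IsOBT.pairwise_aedisjoint_boundaryVisit (hg : IsOBT Gbar G0 μ 𝓕 G Y)
    (hfin : ∀ x, (Gbar.neighborSet x).Finite) (x : V) :
    Pairwise (Function.onFun (AEDisjoint μ) fun t => boundaryVisit Gbar G Y t x) := by
  have : Std.Symm (Function.onFun (AEDisjoint μ) fun t => boundaryVisit Gbar G Y t x) :=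
    ⟨fun _ _ h => h.symm⟩
  refine pairwise_iff_lt.2 fun s t hst => measure_eq_zero_iff_ae_notMem.2 ?_
  filter_upwards [hg.ae_monotone, hg.ae_mem_boundary_iff hfin, hg.opens s]
    with ω hmono hboundary hopens
  rintro ⟨hs, -, y, hxy, hy⟩
  obtain rfl : Y s ω = x := hs.1
  exact hy (hmono (Nat.succ_le_of_lt hst) (hopens ((hboundary s).2 hs) y hxy))

variable [DiscreteMeasurableSpace V]

namespace IsTouchGrowth

variable (hg : IsTouchGrowth Gbar G0 μ 𝓕 G Y)
include hg

lemma measurableSet_visit (t : ℕ) (x : V) : MeasurableSet[𝓕 t] {ω | Y t ω = x} :=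
  hg.adapted_walk t (measurableSet_singleton x)

lemma measurableSet_boundaryVisit [Countable V] (t : ℕ) (x : V) :
    MeasurableSet[𝓕 t] (boundaryVisit Gbar G Y t x) := by
  have : boundaryVisit Gbar G Y t x =
      {ω | Y t ω = x} ∩ ⋃ y, ⋃ _ : Gbar.Adj x y, {ω | (G t ω).Adj x y}ᶜ := by
    ext ω; simp [boundaryVisit]
  rw [this]
  exact (hg.measurableSet_visit t x).inter
    (.iUnion fun y => .iUnion fun _ => (hg.adapted_graph t x y).compl)

lemma measurableSet_opening [Countable V] (t : ℕ) : MeasurableSet (opening G Y t) := by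
  have : opening G Y t = ⋃ x, ⋃ y, {ω | Y t ω = x} ∩
      ({ω | (G (t + 1) ω).Adj x y} ∩ {ω | (G t ω).Adj x y}ᶜ) := by
    ext ω; simp [opening]
  rw [this]
  exact .iUnion fun x => .iUnion fun y => (𝓕.le t _ (hg.measurableSet_visit t x)).inter
    ((𝓕.le _ _ (hg.adapted_graph (t + 1) x y)).inter (𝓕.le _ _ (hg.adapted_graph t x y)).compl)

end IsTouchGrowth

lemma IsOBT.tsum_measure_boundaryVisit_le [Countable V] (hg : IsOBT Gbar G0 μ 𝓕 G Y)
    (hfin : ∀ x, (Gbar.neighborSet x).Finite) (x : V) :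
    ∑' t, μ (boundaryVisit Gbar G Y t x) ≤ μ Set.univ :=
  tsum_measure_le_measure_univ
    (fun t => (𝓕.le t _ (hg.measurableSet_boundaryVisit t x)).nullMeasurableSet)
    (hg.pairwise_aedisjoint_boundaryVisit hfin x)

lemma IsTouchGrowth.tsum_measure_boundaryVisit_inter_opening_le [Countable V]
    (hg : IsTouchGrowth Gbar G0 μ 𝓕 G Y) {x : V} (hfin : (Gbar.neighborSet x).Finite) :
    ∑' t, μ (boundaryVisit Gbar G Y t x ∩ opening G Y t) ≤
      (Gbar.neighborSet x).ncard * μ Set.univ := by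
  have hfinite {ω : Ω} (hle : ∀ t, G t ω ≤ Gbar) (t : ℕ) : ((G t ω).neighborSet x).Finite :=
    hfin.subset fun y hy => hle t hy
  refine tsum_measure_le_of_strictly_increasing_on (φ := fun t ω => ((G t ω).neighborSet x).ncard)
    (fun t => (𝓕.le t _ (hg.measurableSet_boundaryVisit t x)).inter (hg.measurableSet_opening t))
    ?_ ?_ ?_
  · filter_upwards [ae_all_iff.mpr hg.le_ambient] with ω hle t
    exact Set.ncard_le_ncard (fun y hy => hle t hy) hfin
  · filter_upwards [ae_all_iff.mpr hg.le_ambient, hg.ae_monotone] with ω hle hmono t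
    exact Set.ncard_le_ncard (fun y hy => hmono t.le_succ hy) (hfinite hle _)
  · filter_upwards [ae_all_iff.mpr hg.le_ambient, hg.ae_monotone] with ω hle hmono t hω
    obtain ⟨⟨rfl, -⟩, y, hnew, hold⟩ := hω
    exact Set.ncard_lt_ncard ⟨fun z hz => hmono t.le_succ hz, fun h => hold (h hnew)⟩
      (hfinite hle _)

lemma IsPOBT.exists_tsum_measure_boundaryVisit_le [Countable V] [IsFiniteMeasure μ]
    (hg : IsPOBT Gbar G0 μ 𝓕 G Y) (hfin : ∀ x, (Gbar.neighborSet x).Finite)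
    {D : ℕ} (hD : ∀ x, (Gbar.neighborSet x).ncard ≤ D) :
    ∃ K : ℝ≥0∞, K ≠ ∞ ∧ ∀ x, ∑' t, μ (boundaryVisit Gbar G Y t x) ≤ K := by
  obtain ⟨ε, hε, hopens⟩ := hg.opens_with_prob
  have hopening (t : ℕ) (x : V) : ENNReal.ofReal ε * μ (boundaryVisit Gbar G Y t x) ≤
      μ (boundaryVisit Gbar G Y t x ∩ opening G Y t) := by
    refine ofReal_mul_measure_le_measure_inter (𝓕.le t) (hg.measurableSet_boundaryVisit t x)
      (hg.measurableSet_opening t) ?_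
    filter_upwards [hopens t, hg.ae_mem_boundary_iff hfin] with ω hω hboundary hvisit
    obtain rfl : Y t ω = x := hvisit.1
    exact hω ((hboundary t).2 hvisit)
  refine ⟨D * μ Set.univ / ENNReal.ofReal ε,
    ENNReal.div_ne_top (ENNReal.mul_ne_top (by simp) (measure_ne_top _ _)) (by simpa using hε),
    fun x => ?_⟩
  rw [ENNReal.le_div_iff_mul_le (Or.inl (by simpa using hε)) (by simp), mul_comm,
    ← ENNReal.tsum_mul_left]
  calc ∑' t, ENNReal.ofReal ε * μ (boundaryVisit Gbar G Y t x)
      ≤ ∑' t, μ (boundaryVisit Gbar G Y t x ∩ opening G Y t) :=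
        ENNReal.tsum_le_tsum fun t => hopening t x
    _ ≤ (Gbar.neighborSet x).ncard * μ Set.univ :=
        hg.tsum_measure_boundaryVisit_inter_opening_le (hfin x)
    _ ≤ D * μ Set.univ := by gcongr; exact hD x

namespace IsExtendedSRW

variable (hY : IsExtendedSRW Gbar o r μ 𝓕 G Y) (hg : IsTouchGrowth Gbar G0 μ 𝓕 G Y)
  (hfin : ∀ x, (Gbar.neighborSet x).Finite)
include hY hg hfin

lemma infinite_visits_of_adj [IsFiniteMeasure μ] {x y : V} (hxy : Gbar.Adj x y)
    (hbv : ∑' t, μ (boundaryVisit Gbar G Y t x) ≠ ∞) :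
    ∀ᵐ ω ∂μ, {t | Y t ω = x}.Infinite → {t | Y t ω = y}.Infinite := by
  have hpos : 0 < (srwStep Gbar x).real {y} :=
    ENNReal.toReal_pos (srwStep_singleton_ne_zero (hfin x) hxy) (measure_ne_top _ _)
  have hnonneg (t : ℕ) : 0 ≤ᵐ[μ] μ⟦{ω | Y (t + 1) ω = y} | 𝓕 t⟧ :=
    condExp_nonneg (ae_of_all _ fun ω => Set.indicator_nonneg (by simp) ω)
  filter_upwards [ae_mem_limsup_atTop_iff μ fun t => hg.measurableSet_visit t y,
    ae_all_iff.2 hnonneg, ae_finite_setOfPred_mem hbv, ae_all_iff.2 fun t => hY.step t y,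
    hg.ae_mem_boundary_iff hfin] with ω hlevy hnonneg hbfin hstep hboundary hinf
  rw [mem_limsup_iff_frequently_mem, Nat.frequently_atTop_iff_infinite] at hlevy
  refine hlevy.2 ((not_summable_iff_tendsto_nat_atTop_of_nonneg hnonneg).1 fun hsum => ?_)
  have hoff : ∃ᶠ t in atTop, Y t ω = x ∧ ω ∉ boundaryVisit Gbar G Y t x :=
    Nat.frequently_atTop_iff_infinite.2 (hinf.sdiff hbfin)
  obtain ⟨t, ⟨rfl, ht⟩, hsmall⟩ :=
    (hoff.and_eventually (hsum.tendsto_atTop_zero.eventually (gt_mem_nhds hpos))).exists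
  exact hsmall.ne (hstep t fun h => ht ((hboundary t).1 h))

variable [Countable V]

lemma setLIntegral_compl_boundaryVisit [IsFiniteMeasure μ] (f : V → ℝ≥0∞) (t : ℕ) :
    ∫⁻ ω in (⋃ x, boundaryVisit Gbar G Y t x)ᶜ, f (Y (t + 1) ω) ∂μ =
      ∫⁻ ω in (⋃ x, boundaryVisit Gbar G Y t x)ᶜ, stepMean Gbar f (Y t ω) ∂μ := by
  have hYm (s : ℕ) : Measurable (Y s) := (hg.adapted_walk s).mono (𝓕.le s) le_rfl
  refine setLIntegral_comp_of_condProb_eq (κ := (srwKernel Gbar).comap (Y t) (hYm t))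
    (hYm (t + 1)) (𝓕.le t) (.compl (.iUnion (hg.measurableSet_boundaryVisit t))) (fun y => ?_) f
  filter_upwards [hY.step t y, hg.ae_mem_boundary_iff hfin] with ω hstep hboundary hω
  exact hstep fun h => hω (Set.mem_iUnion_of_mem _ ((hboundary t).1 h))

lemma setLIntegral_boundaryVisit_le (f : V → ℝ≥0∞) (t : ℕ) :
    ∫⁻ ω in ⋃ x, boundaryVisit Gbar G Y t x, f (Y (t + 1) ω) ∂μ ≤
      ∑' x, (⨆ y ∈ ball Gbar x (r x), f y) * μ (boundaryVisit Gbar G Y t x) := by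
  refine (lintegral_iUnion_le _ _).trans (ENNReal.tsum_le_tsum fun x => ?_)
  rw [← setLIntegral_const]
  refine setLIntegral_mono_ae' (𝓕.le t _ (hg.measurableSet_boundaryVisit t x)) ?_
  filter_upwards [hY.jump t, hg.ae_mem_boundary_iff hfin] with ω hjump hboundary hω
  obtain rfl : Y t ω = x := hω.1
  exact le_biSup f (hjump ((hboundary t).2 hω))

lemma lintegral_add_le_of_superharmonic [IsFiniteMeasure μ] {z : V} {δ : ℝ≥0∞}
    (hf : ∀ y, stepMean Gbar f y + ({z} : Set V).indicator (fun _ => δ) y ≤ f y) (t : ℕ) :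
    ∫⁻ ω, f (Y (t + 1) ω) ∂μ + δ * μ ({ω | Y t ω = z} \ ⋃ x, boundaryVisit Gbar G Y t x) ≤
      ∫⁻ ω, f (Y t ω) ∂μ +
        ∑' x, (⨆ y ∈ ball Gbar x (r x), f y) * μ (boundaryVisit Gbar G Y t x) := by
  set B := ⋃ x, boundaryVisit Gbar G Y t x
  have hB : MeasurableSet B :=
    .iUnion fun x => 𝓕.le t _ (hg.measurableSet_boundaryVisit t x)
  have hz : MeasurableSet {ω | Y t ω = z} := 𝓕.le t _ (hg.measurableSet_visit t z)
  have hoff : ∫⁻ ω in Bᶜ, f (Y (t + 1) ω) ∂μ + δ * μ ({ω | Y t ω = z} \ B) ≤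
      ∫⁻ ω, f (Y t ω) ∂μ := by
    rw [hY.setLIntegral_compl_boundaryVisit hg hfin, Set.sdiff_eq, ← Measure.restrict_apply hz,
      ← lintegral_indicator_const hz, ← lintegral_add_right _ (measurable_const.indicator hz)]
    exact (lintegral_mono fun ω => hf (Y t ω)).trans (setLIntegral_le_lintegral _ _)
  rw [← lintegral_add_compl _ hB, add_assoc, add_comm]
  exact add_le_add hoff (hY.setLIntegral_boundaryVisit_le hg hfin f t)

lemma tsum_measure_visit_start_ne_top [IsFiniteMeasure μ]
    (hret : stepMean Gbar (hitProb Gbar o) o < 1) (hS : Sstar Gbar G0 o r < ∞) {K : ℝ≥0∞}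
    (hK : K ≠ ∞) (hbv : ∀ x, ∑' t, μ (boundaryVisit Gbar G Y t x) ≤ K) :
    ∑' t, μ {ω | Y t ω = o} ≠ ∞ := by
  set B := fun t => ⋃ x, boundaryVisit Gbar G Y t x
  set δ := 1 - stepMean Gbar (hitProb Gbar o) o
  have hoff : δ * ∑' t, μ ({ω | Y t ω = o} \ B t) ≠ ∞ := by
    rw [← ENNReal.tsum_mul_left]
    refine ne_top_of_le_ne_top ?_ (tsum_le_of_add_le_add <|
      hY.lintegral_add_le_of_superharmonic hg hfin
        fun y => (stepMean_hitProb_add_indicator hret y).le)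
    have hstart : ∫⁻ ω, hitProb Gbar o (Y 0 ω) ∂μ ≤ μ Set.univ :=
      (lintegral_mono fun ω => hitProb_le_one _).trans_eq lintegral_one
    exact ENNReal.add_ne_top.2 ⟨ne_top_of_le_ne_top (measure_ne_top _ _) hstart,
      ne_top_of_le_ne_top (ENNReal.mul_ne_top hS.ne hK)
        (hg.tsum_mul_measure_boundaryVisit_le hfin hbv _)⟩
  have hcover (t : ℕ) : {ω | Y t ω = o} ⊆
      ({ω | Y t ω = o} \ B t) ∪ boundaryVisit Gbar G Y t o := by
    intro ω hω
    refine or_iff_not_imp_left.2 fun hωB => ?_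
    obtain ⟨x, hx⟩ := Set.mem_iUnion.1 (not_not.1 fun h => hωB ⟨hω, h⟩)
    obtain rfl : x = o := hx.1.symm.trans hω
    exact hx
  refine ne_top_of_le_ne_top (ENNReal.add_ne_top.2 ⟨?_, ne_top_of_le_ne_top hK (hbv o)⟩)
    ((ENNReal.tsum_le_tsum fun t => (measure_mono (hcover t)).trans (measure_union_le _ _)).trans_eq
      ENNReal.tsum_add)
  exact fun htop => hoff (htop ▸ ENNReal.mul_top (tsub_pos_of_lt hret).ne')

theorem almostSurelyTransient_of_tsum_boundaryVisit_le [IsFiniteMeasure μ]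
    (hconn : Gbar.Connected) (hret : stepMean Gbar (hitProb Gbar o) o < 1)
    (hS : Sstar Gbar G0 o r < ∞) {K : ℝ≥0∞} (hK : K ≠ ∞)
    (hbv : ∀ x, ∑' t, μ (boundaryVisit Gbar G Y t x) ≤ K) : AlmostSurelyTransient μ Y := by
  refine ae_all_iff.2 fun x => ?_
  have hreach := (SimpleGraph.reachable_iff_reflTransGen x o).1 (hconn.preconnected x o)
  induction hreach using Relation.ReflTransGen.head_induction_on with
  | refl =>
    exact ae_finite_setOfPred_mem (hY.tsum_measure_visit_start_ne_top hg hfin hret hS hK hbv)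
  | @head x y hxy _ hy =>
    filter_upwards [hy, hY.infinite_visits_of_adj hg hfin hxy (ne_top_of_le_ne_top hK (hbv x))]
      with ω hfinite himp
    by_contra hinf
    exact himp hinf hfinite

end IsExtendedSRW

end Growth

section Superharmonic

open scoped NNReal

lemma exists_abs_one_add_rpow_sub_sum_le (p : ℝ) (n : ℕ) {r : ℝ≥0} (hr : r < 1) :
    ∃ C > 0, ∀ t : ℝ, |t| < r →
      |(1 + t) ^ p - ∑ k ∈ Finset.range n, Ring.choose p k * t ^ k| ≤ C * |t| ^ n := by
  obtain ⟨a, ha, C, hC, happrox⟩ :=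
    (Real.one_add_rpow_hasFPowerSeriesOnBall_zero (a := p)).uniform_geometric_approx'
      (r' := r) (mod_cast hr)
  rcases eq_zero_or_pos r with rfl | hr0
  · exact ⟨1, one_pos, fun t ht => absurd ht (by simp)⟩
  have := ha.1
  refine ⟨C * (a / r) ^ n, by positivity, fun t ht => ?_⟩
  calc |(1 + t) ^ p - ∑ k ∈ Finset.range n, Ring.choose p k * t ^ k|
      ≤ C * (a * (|t| / r)) ^ n := by
        simpa [FormalMultilinearSeries.partialSum, binomialSeries,
          FormalMultilinearSeries.coeff_ofScalars, mul_comm] using happrox t (by simpa using ht) n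
    _ = C * (a / r) ^ n * |t| ^ n := by ring

/-- The odd terms of the two binomial series cancel. -/
lemma exists_one_add_rpow_add_one_sub_rpow_le (s : ℝ) : ∃ C > 0, ∀ t : ℝ, |t| ≤ 1 / 2 →
    (1 + t) ^ (-s) + (1 - t) ^ (-s) ≤ 2 + s * (s + 1) * t ^ 2 + C * t ^ 4 := by
  obtain ⟨C, hC, happrox⟩ :=
    exists_abs_one_add_rpow_sub_sum_le (-s) 4 (r := 3 / 4) (by norm_num [← NNReal.coe_lt_coe])
  refine ⟨2 * C, by positivity, fun t ht => ?_⟩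
  have ht' : |t| < (3 / 4 : ℝ≥0) := ht.trans_lt (by norm_num)
  have hplus := (abs_le.1 (happrox t ht')).2
  have hminus := (abs_le.1 (happrox (-t) (by rwa [abs_neg]))).2
  simp only [abs_neg, Even.pow_abs (by decide : Even 4), ← sub_eq_add_neg,
    Finset.sum_range_succ, Finset.sum_range_zero] at hplus hminus
  have h2 : Ring.choose (-s) 2 = s * (s + 1) / 2 := by
    have hpoly : descPochhammer ℤ 2 = Polynomial.X * (Polynomial.X - 1) := by
      simp [descPochhammer_succ_right]
    rw [Ring.choose_eq_smul, hpoly, ← Polynomial.aeval_eq_smeval]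
    simp only [map_mul, map_sub, map_one, Polynomial.aeval_X, Nat.factorial]
    norm_num
    ring
  have h0 : Ring.choose (-s) 0 = 1 := Ring.choose_zero_right _
  rw [h2, h0] at hplus hminus
  linear_combination hplus + hminus

lemma exists_add_rpow_add_sub_rpow_le (s : ℝ) : ∃ C > 0, ∀ v y : ℝ, 0 < v → 2 * |y| ≤ v →
    (v + y) ^ (-s) + (v - y) ^ (-s) ≤
      v ^ (-s) * (2 + s * (s + 1) * (y / v) ^ 2 + C * (y / v) ^ 4) := by
  obtain ⟨C, hC, hexpansion⟩ := exists_one_add_rpow_add_one_sub_rpow_le s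
  refine ⟨C, hC, fun v y hv hy => ?_⟩
  have ht : |y / v| ≤ 1 / 2 := by
    rw [abs_div, abs_of_pos hv, div_le_iff₀ hv]
    linarith
  have hbounds := abs_le.1 ht
  have hadd : v + y = v * (1 + y / v) := by field_simp
  have hsub : v - y = v * (1 - y / v) := by field_simp
  rw [hadd, hsub, Real.mul_rpow hv.le (by linarith), Real.mul_rpow hv.le (by linarith), ← mul_add]
  exact mul_le_mul_of_nonneg_left (hexpansion _ ht) (Real.rpow_nonneg hv.le _)

lemma rpow_neg_mul_tangent_le {s u v : ℝ} (hs : 0 ≤ s) (hu : 0 < u) (hv : 0 < v) :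
    v ^ (-s) * (1 + s * ((v - u) / v)) ≤ u ^ (-s) := by
  have hlog : (v - u) / v ≤ Real.log (v / u) := by
    simpa [sub_div, hv.ne'] using Real.one_sub_inv_le_log_of_pos (div_pos hv hu)
  calc v ^ (-s) * (1 + s * ((v - u) / v))
      ≤ v ^ (-s) * Real.exp (s * Real.log (v / u)) := by
        gcongr
        rw [add_comm]
        exact (Real.add_one_le_exp _).trans (by gcongr)
    _ = v ^ (-s) * (v ^ s / u ^ s) := by
        rw [mul_comm s, ← Real.rpow_def_of_pos (div_pos hv hu), Real.div_rpow hv.le hu.le]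
    _ = u ^ (-s) := by
        rw [Real.rpow_neg hv.le, Real.rpow_neg hu.le]
        field_simp

variable {ι : Type*} [Fintype ι]

lemma sum_expansion_le {s C v : ℝ} (hs : 0 < s) (hC : 0 ≤ C)
    (hι : 2 * (s + 1) ≤ Fintype.card ι) {x : ι → ℝ}
    (hv : ∑ j, x j ^ 2 + 8 * C / (Fintype.card ι * s) ≤ v) (hv0 : 0 < v) :
    ∑ i, (2 + s * (s + 1) * (2 * x i / v) ^ 2 + C * (2 * x i / v) ^ 4) ≤
      2 * Fintype.card ι * (1 + s / v) := by
  set q := ∑ j, x j ^ 2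
  set d : ℝ := (Fintype.card ι : ℝ)
  have hq : 0 ≤ q := Finset.sum_nonneg fun j _ => sq_nonneg _
  have hd : 0 < d := by linarith
  have hquartic : ∑ i, x i ^ 4 ≤ q ^ 2 := by
    simpa only [← pow_mul] using Finset.sum_sq_le_sq_sum_of_nonneg fun i _ => sq_nonneg (x i)
  have hqv : q ≤ v := le_trans (by simpa using by positivity) hv
  calc ∑ i, (2 + s * (s + 1) * (2 * x i / v) ^ 2 + C * (2 * x i / v) ^ 4)
      = 2 * d + 2 * (s + 1) * (2 * s * q / v ^ 2) + 16 * C * (∑ i, x i ^ 4) / v ^ 4 := by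
        simp only [div_pow, mul_pow, Finset.sum_add_distrib, ← Finset.mul_sum, ← Finset.sum_div,
          Finset.sum_const, Finset.card_univ, nsmul_eq_mul]
        ring
    _ ≤ 2 * d + d * (2 * s * q / v ^ 2) + 16 * C * v ^ 2 / v ^ 4 := by
        gcongr
        exact hquartic.trans (pow_le_pow_left₀ hq hqv 2)
    _ = 2 * d + 2 * d * s * (q + 8 * C / (d * s)) / v ^ 2 := by
        field_simp
        ring
    _ ≤ 2 * d + 2 * d * s * v / v ^ 2 := by gcongr
    _ = 2 * d * (1 + s / v) := by field_simp

lemma exists_sum_rpow_neg_le {s : ℝ} (hs : 0 < s) (hι : 2 * (s + 1) ≤ Fintype.card ι) :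
    ∃ a > 0, ∀ x : ι → ℝ,
      ∑ i, ((∑ j, x j ^ 2 + a + 1 + 2 * x i) ^ (-s) + (∑ j, x j ^ 2 + a + 1 - 2 * x i) ^ (-s)) ≤
        2 * Fintype.card ι * (∑ j, x j ^ 2 + a) ^ (-s) := by
  obtain ⟨C, hC, hpair⟩ := exists_add_rpow_add_sub_rpow_le s
  have hbound : 0 ≤ 8 * C / (Fintype.card ι * s) := by positivity
  refine ⟨3 + 8 * C / (Fintype.card ι * s), by positivity, fun x => ?_⟩
  set a := 3 + 8 * C / (Fintype.card ι * s)
  set q := ∑ j, x j ^ 2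
  have : 0 ≤ q := Finset.sum_nonneg fun j _ => sq_nonneg _
  set v := q + a + 1
  have hsmall (i : ι) : 2 * |2 * x i| ≤ v := by
    have hxq : x i ^ 2 ≤ q :=
      Finset.single_le_sum (f := fun j => x j ^ 2) (fun j _ => sq_nonneg _) (Finset.mem_univ i)
    rw [abs_mul, abs_two]
    nlinarith [sq_nonneg (|x i| - 2), sq_abs (x i)]
  have hv : 0 < v := by positivity
  calc ∑ i, ((v + 2 * x i) ^ (-s) + (v - 2 * x i) ^ (-s))
      ≤ v ^ (-s) * ∑ i, (2 + s * (s + 1) * (2 * x i / v) ^ 2 + C * (2 * x i / v) ^ 4) := by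
        rw [Finset.mul_sum]
        exact Finset.sum_le_sum fun i _ => hpair v _ hv (hsmall i)
    _ ≤ v ^ (-s) * (2 * Fintype.card ι * (1 + s / v)) := by
        gcongr
        exact sum_expansion_le hs hC.le hι (by linarith) hv
    _ = 2 * Fintype.card ι * (v ^ (-s) * (1 + s * ((v - (q + a)) / v))) := by
        rw [show v - (q + a) = 1 by ring]
        ring
    _ ≤ 2 * Fintype.card ι * (q + a) ^ (-s) := by
        gcongr
        exact rpow_neg_mul_tangent_le hs.le (by positivity) hv

end Superharmonic

section Lattice

variable {d : ℕ}

lemma tsum_comp_eq_tsum_encard_mul {α β : Type*} (S : Set α) (b : α → β) (g : β → ℝ≥0∞) :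
    ∑' x : S, g (b x) = ∑' k, ((S ∩ b ⁻¹' {k}).encard : ℝ≥0∞) * g k := by
  rw [← ENNReal.tsum_fiberwise _ fun x : S => b x]
  refine tsum_congr fun k => ?_
  have hconst (x : (fun x : S => b x) ⁻¹' {k}) : g (b (x : S)) = g k := congrArg g x.2
  have hcard : ((fun x : S => b x) ⁻¹' {k}).encard = (S ∩ b ⁻¹' {k}).encard := by
    rw [← Subtype.val_injective.encard_image, ← Subtype.image_preimage_coe]
    rfl
  rw [tsum_congr hconst, ENNReal.tsum_set_const, hcard]

lemma ball_subset_ball {V : Type*} {G : SimpleGraph V} {x : V} {ρ ρ' : ℝ} (h : ρ ≤ ρ') :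
    ball G x ρ ⊆ ball G x ρ' := fun _ hy => le_trans hy h

lemma one_sub_mul_dist_le_of_mem_ball {V : Type*} {G : SimpleGraph V} (hconn : G.Connected)
    {o x y : V} {c : ℝ} (hc : 0 ≤ c) (hy : y ∈ ball G x (max 1 (c * G.dist x o))) :
    (1 - c) * G.dist x o ≤ 1 + G.dist y o := by
  have htriangle : (G.dist x o : ℝ) ≤ G.dist x y + G.dist y o := mod_cast hconn.dist_triangle
  have hmul : 0 ≤ c * (G.dist x o : ℝ) := by positivity
  rcases le_max_iff.1 (show (G.dist x y : ℝ) ≤ max 1 (c * G.dist x o) from hy) with h | h <;>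
    linarith [Nat.cast_nonneg (α := ℝ) (G.dist y o)]

/-- The `2 d` steps `± eᵢ` of the nearest-neighbour walk on `ℤ^d`. -/
def latticeStep (p : Fin d × ℤˣ) : Fin d → ℤ := Pi.single p.1 (p.2 : ℤ)

lemma latticeStep_injective : Function.Injective (latticeStep (d := d)) := by
  rintro ⟨i, ε⟩ ⟨j, δ⟩ h
  obtain rfl : i = j := by
    by_contra hij
    simpa [latticeStep, Pi.single_eq_of_ne hij] using congrFun h i
  simpa [latticeStep, Units.ext_iff] using h

/-- The `ℓ¹` distance on `ℤ^d`. -/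
def l1Dist (x y : Fin d → ℤ) : ℕ := ∑ i, (x i - y i).natAbs

lemma l1Dist_triangle (x y z : Fin d → ℤ) : l1Dist x z ≤ l1Dist x y + l1Dist y z := by
  unfold l1Dist
  rw [← Finset.sum_add_distrib]
  exact Finset.sum_le_sum fun i _ => by omega

lemma l1Dist_eq_zero {x y : Fin d → ℤ} : l1Dist x y = 0 ↔ x = y := by
  simp [l1Dist, sub_eq_zero, funext_iff]

lemma latticeGraph_adj_iff {x y : Fin d → ℤ} : (latticeGraph d).Adj x y ↔ l1Dist x y = 1 := by
  change ∑ i, |x i - y i| = 1 ↔ _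
  rw [l1Dist, ← Nat.cast_inj (R := ℤ)]
  push_cast
  rfl

lemma latticeGraph_adj_add_latticeStep (x : Fin d → ℤ) (p : Fin d × ℤˣ) :
    (latticeGraph d).Adj x (x + latticeStep p) := by
  rw [latticeGraph_adj_iff, l1Dist, Finset.sum_eq_single p.1]
  · simp [latticeStep]
  · intro j _ hj
    simp [latticeStep, Pi.single_eq_of_ne hj]
  · simp

lemma exists_l1Dist_add_latticeStep {x y : Fin d → ℤ} (hxy : x ≠ y) :
    ∃ p, l1Dist (x + latticeStep p) y + 1 = l1Dist x y := by
  obtain ⟨i, hi⟩ := Function.ne_iff.mp hxy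
  obtain ⟨ε, hε⟩ : ∃ ε : ℤˣ, (x i + ε - y i).natAbs + 1 = (x i - y i).natAbs := by
    rcases hi.lt_or_gt with h | h
    · exact ⟨1, by rw [Units.val_one]; omega⟩
    · exact ⟨-1, by rw [Units.val_neg, Units.val_one]; omega⟩
  have hother : ∀ j ∈ Finset.univ.erase i,
      ((x + latticeStep (i, ε)) j - y j).natAbs = (x j - y j).natAbs := fun j hj => by
    simp [latticeStep, Pi.single_eq_of_ne (Finset.ne_of_mem_erase hj)]
  refine ⟨(i, ε), ?_⟩
  rw [l1Dist, l1Dist, ← Finset.add_sum_erase _ _ (Finset.mem_univ i),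
    ← Finset.add_sum_erase _ (fun j => (x j - y j).natAbs) (Finset.mem_univ i),
    Finset.sum_congr rfl hother, ← hε, add_right_comm]
  simp [latticeStep]

lemma exists_walk_length_eq_l1Dist (x y : Fin d → ℤ) :
    ∃ p : (latticeGraph d).Walk x y, p.length = l1Dist x y := by
  induction h : l1Dist x y generalizing x with
  | zero =>
    obtain rfl := l1Dist_eq_zero.1 h
    exact ⟨.nil, rfl⟩
  | succ n ih =>
    have hxy : x ≠ y := fun hxy => by simp [l1Dist_eq_zero.2 hxy] at h
    obtain ⟨p, hp⟩ := exists_l1Dist_add_latticeStep hxy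
    obtain ⟨q, hq⟩ := ih (x + latticeStep p) (by omega)
    exact ⟨.cons (latticeGraph_adj_add_latticeStep x p) q, by simp [hq]⟩

lemma l1Dist_le_length {x y : Fin d → ℤ} (p : (latticeGraph d).Walk x y) :
    l1Dist x y ≤ p.length := by
  induction p with
  | nil => exact (l1Dist_eq_zero.2 rfl).le
  | @cons x y z hxy p ih =>
    have htriangle := l1Dist_triangle x y z
    have hstep := latticeGraph_adj_iff.1 hxy
    rw [SimpleGraph.Walk.length_cons]
    omega

lemma latticeGraph_connected : (latticeGraph d).Connected :=
  ⟨fun x y => ⟨(exists_walk_length_eq_l1Dist x y).choose⟩⟩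

lemma latticeGraph_dist (x y : Fin d → ℤ) : (latticeGraph d).dist x y = l1Dist x y := by
  refine le_antisymm ?_ ?_
  · obtain ⟨p, hp⟩ := exists_walk_length_eq_l1Dist x y
    exact hp ▸ SimpleGraph.dist_le p
  · obtain ⟨p, hp⟩ := latticeGraph_connected.exists_walk_length_eq_dist x y
    exact hp ▸ l1Dist_le_length p

lemma latticeGraph_neighborSet (x : Fin d → ℤ) :
    (latticeGraph d).neighborSet x =
      (Finset.univ.image fun p => x + latticeStep p : Finset (Fin d → ℤ)) := by
  ext y
  simp only [SimpleGraph.mem_neighborSet, Finset.coe_image, Finset.coe_univ,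
    Set.image_univ, Set.mem_range]
  refine ⟨fun h => ?_, ?_⟩
  · obtain ⟨p, hp⟩ := exists_l1Dist_add_latticeStep h.ne
    rw [latticeGraph_adj_iff] at h
    exact ⟨p, l1Dist_eq_zero.1 (by omega)⟩
  · rintro ⟨p, rfl⟩
    exact latticeGraph_adj_add_latticeStep x p

lemma latticeGraph_neighborSet_finite (x : Fin d → ℤ) :
    ((latticeGraph d).neighborSet x).Finite := by
  rw [latticeGraph_neighborSet]
  exact Finset.finite_toSet _

lemma add_latticeStep_injective (x : Fin d → ℤ) : Function.Injective fun p => x + latticeStep p :=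
  (add_right_injective x).comp latticeStep_injective

lemma card_image_add_latticeStep (x : Fin d → ℤ) :
    (Finset.univ.image fun p => x + latticeStep p).card = 2 * d := by
  rw [Finset.card_image_of_injective _ (add_latticeStep_injective x)]
  simp [mul_comm]

lemma latticeGraph_ncard_neighborSet (x : Fin d → ℤ) :
    ((latticeGraph d).neighborSet x).ncard = 2 * d := by
  rw [latticeGraph_neighborSet, Set.ncard_coe_finset, card_image_add_latticeStep]

lemma lintegral_uniformOn_finset {α : Type*} [MeasurableSpace α] [MeasurableSingletonClass α]
    (s : Finset α) (f : α → ℝ≥0∞) :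
    ∫⁻ x, f x ∂(uniformOn (s : Set α)) = (s.card : ℝ≥0∞)⁻¹ * ∑ x ∈ s, f x := by
  rw [uniformOn, ProbabilityTheory.cond, lintegral_smul_measure, lintegral_finset]
  simp

lemma stepMean_latticeGraph_ofReal (hd : 0 < d) {φ : (Fin d → ℤ) → ℝ} (hφ : ∀ x, 0 ≤ φ x)
    (x : Fin d → ℤ) :
    stepMean (latticeGraph d) (fun y => ENNReal.ofReal (φ y)) x =
      ENNReal.ofReal ((2 * d : ℝ)⁻¹ * ∑ i, ∑ ε : ℤˣ, φ (x + latticeStep (i, ε))) := by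
  have hne : ((latticeGraph d).neighborSet x).Nonempty :=
    ⟨_, latticeGraph_adj_add_latticeStep x (⟨0, hd⟩, 1)⟩
  rw [stepMean, srwStep, if_pos ⟨latticeGraph_neighborSet_finite x, hne⟩,
    latticeGraph_neighborSet, lintegral_uniformOn_finset, card_image_add_latticeStep,
    Finset.sum_image (add_latticeStep_injective x).injOn,
    ← ENNReal.ofReal_sum_of_nonneg fun _ _ => hφ _, ← Fintype.sum_prod_type',
    ENNReal.ofReal_mul (by positivity), ENNReal.ofReal_inv_of_pos (by positivity)]
  congr
  exact mod_cast (ENNReal.ofReal_natCast (2 * d)).symm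

/-- The squared Euclidean norm of a lattice site. -/
def sqNorm (x : Fin d → ℤ) : ℝ := ∑ i, (x i : ℝ) ^ 2

lemma sqNorm_nonneg (x : Fin d → ℤ) : 0 ≤ sqNorm x := Finset.sum_nonneg fun _ _ => sq_nonneg _

lemma sqNorm_add_latticeStep (x : Fin d → ℤ) (i : Fin d) (ε : ℤˣ) :
    sqNorm (x + latticeStep (i, ε)) = sqNorm x + 1 + 2 * (ε : ℤ) * x i := by
  have hε : ((ε : ℤ) : ℝ) ^ 2 = 1 := by
    rcases Int.units_eq_one_or ε with rfl | rfl <;> norm_num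
  have hother : ∀ j ∈ Finset.univ.erase i,
      ((x + latticeStep (i, ε)) j : ℝ) ^ 2 = (x j : ℝ) ^ 2 := fun j hj => by
    simp [latticeStep, Pi.single_eq_of_ne (Finset.ne_of_mem_erase hj)]
  have hself : ((x + latticeStep (i, ε)) i : ℝ) = x i + (ε : ℤ) := by simp [latticeStep]
  rw [sqNorm, sqNorm, ← Finset.add_sum_erase _ _ (Finset.mem_univ i),
    ← Finset.add_sum_erase _ (fun j => (x j : ℝ) ^ 2) (Finset.mem_univ i),
    Finset.sum_congr rfl hother, hself]
  linear_combination hε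

lemma sq_dist_zero_le (x : Fin d → ℤ) : ((latticeGraph d).dist x 0 : ℝ) ^ 2 ≤ d * sqNorm x := by
  have hl1 : (l1Dist x 0 : ℝ) = ∑ i, |(x i : ℝ)| := by simp [l1Dist, Nat.cast_natAbs]
  rw [latticeGraph_dist, hl1, sqNorm]
  simpa using sq_sum_le_card_mul_sum_sq (s := Finset.univ) (f := fun i => |(x i : ℝ)|)

/-- A regularization of `|x| ^ (2 - d)`, which is superharmonic on all of `ℤ^d`, including near the
origin, once `a` is large enough. -/
def latticePotential (a : ℝ) (x : Fin d → ℤ) : ℝ := (sqNorm x + a) ^ (-(((d : ℝ) - 2) / 2))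

lemma latticePotential_pos {a : ℝ} (ha : 0 < a) (x : Fin d → ℤ) : 0 < latticePotential a x :=
  Real.rpow_pos_of_pos (add_pos_of_nonneg_of_pos (sqNorm_nonneg x) ha) _

lemma exists_stepMean_latticePotential_le (hd : 3 ≤ d) : ∃ a > 0, ∀ x : Fin d → ℤ,
    stepMean (latticeGraph d) (fun y => ENNReal.ofReal (latticePotential a y)) x ≤
      ENNReal.ofReal (latticePotential a x) := by
  have hd3 : (3 : ℝ) ≤ d := mod_cast hd
  obtain ⟨a, ha, hsum⟩ := exists_sum_rpow_neg_le (ι := Fin d) (s := ((d : ℝ) - 2) / 2)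
    (by linarith) (by rw [Fintype.card_fin]; linarith)
  refine ⟨a, ha, fun x => ?_⟩
  rw [stepMean_latticeGraph_ofReal (by omega) fun y => (latticePotential_pos ha y).le]
  refine ENNReal.ofReal_le_ofReal ((inv_mul_le_iff₀ (by positivity)).2 ?_)
  have hpair (i : Fin d) : ∑ ε : ℤˣ, latticePotential a (x + latticeStep (i, ε)) =
      (sqNorm x + a + 1 + 2 * x i) ^ (-(((d : ℝ) - 2) / 2)) +
        (sqNorm x + a + 1 - 2 * x i) ^ (-(((d : ℝ) - 2) / 2)) := by
    rw [UnitsInt.univ, Finset.sum_pair (by decide)]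
    simp only [latticePotential, sqNorm_add_latticeStep, Units.val_one, Units.val_neg]
    push_cast
    ring_nf
  rw [Finset.sum_congr rfl fun i _ => hpair i]
  simpa only [Fintype.card_fin, sqNorm, latticePotential] using hsum fun i => (x i : ℝ)

lemma stepMean_latticePotential_zero_lt (hd : 3 ≤ d) {a : ℝ} (ha : 0 < a) :
    stepMean (latticeGraph d) (fun y => ENNReal.ofReal (latticePotential a y)) 0 <
      ENNReal.ofReal (latticePotential a (0 : Fin d → ℤ)) := by
  have hd3 : (3 : ℝ) ≤ d := mod_cast hd
  have hstep (i : Fin d) (ε : ℤˣ) :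
      latticePotential a (0 + latticeStep (i, ε)) = (1 + a) ^ (-(((d : ℝ) - 2) / 2)) := by
    rw [latticePotential, sqNorm_add_latticeStep]
    simp [sqNorm]
  have hzero : latticePotential a (0 : Fin d → ℤ) = a ^ (-(((d : ℝ) - 2) / 2)) := by
    simp [latticePotential, sqNorm]
  rw [stepMean_latticeGraph_ofReal (by omega) fun y => (latticePotential_pos ha y).le,
    ENNReal.ofReal_lt_ofReal_iff (latticePotential_pos ha 0),
    inv_mul_lt_iff₀ (by positivity), hzero]
  simp only [hstep, Finset.sum_const, Finset.card_univ, Fintype.card_units_int, Fintype.card_fin,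
    nsmul_eq_mul, Nat.cast_ofNat, mul_left_comm (d : ℝ), mul_assoc]
  gcongr 2 * (d * ?_)
  exact Real.rpow_lt_rpow_of_neg ha (by linarith) (by linarith)

lemma stepMean_hitProb_latticeGraph_lt_one (hd : 3 ≤ d) :
    stepMean (latticeGraph d) (hitProb (latticeGraph d) 0) 0 < 1 := by
  obtain ⟨a, ha, hsuper⟩ := exists_stepMean_latticePotential_le hd
  exact stepMean_hitProb_self_lt_one_of_superharmonic hsuper
    (stepMean_latticePotential_zero_lt hd ha)

lemma exists_hitProb_latticeGraph_le (hd : 3 ≤ d) : ∃ C > 0, ∀ y : Fin d → ℤ,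
    hitProb (latticeGraph d) 0 y ≤
      ENNReal.ofReal (C * (1 + (latticeGraph d).dist y 0 : ℝ) ^ (2 - (d : ℝ))) := by
  obtain ⟨a, ha, hsuper⟩ := exists_stepMean_latticePotential_le hd
  have hd3 : (3 : ℝ) ≤ d := mod_cast hd
  set M := 2 / a + 2 * d
  have hM : 0 < M := by positivity
  refine ⟨M⁻¹ ^ (-(((d : ℝ) - 2) / 2)) / latticePotential a (0 : Fin d → ℤ),
    div_pos (by positivity) (latticePotential_pos ha 0), fun y => ?_⟩
  set ρ : ℝ := 1 + (latticeGraph d).dist y 0 with hρ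
  have hdecay : latticePotential a y ≤ M⁻¹ ^ (-(((d : ℝ) - 2) / 2)) * ρ ^ (2 - (d : ℝ)) := by
    have hnorm : M⁻¹ * ρ ^ 2 ≤ sqNorm y + a := by
      rw [inv_mul_le_iff₀ hM]
      calc ρ ^ 2 ≤ 2 + 2 * (latticeGraph d).dist y 0 ^ 2 := by
            rw [hρ]
            linarith [add_sq_le (a := (1 : ℝ)) (b := (latticeGraph d).dist y 0)]
        _ ≤ 2 + 2 * (d * sqNorm y) := by gcongr; exact sq_dist_zero_le y
        _ ≤ 2 + 2 * (d * sqNorm y) + (2 / a * sqNorm y + 2 * d * a) :=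
            le_add_of_nonneg_right (add_nonneg (mul_nonneg (by positivity) (sqNorm_nonneg y))
              (by positivity))
        _ = M * (sqNorm y + a) := by simp only [M]; field_simp; ring
    calc latticePotential a y ≤ (M⁻¹ * ρ ^ 2) ^ (-(((d : ℝ) - 2) / 2)) :=
          Real.rpow_le_rpow_of_nonpos (by positivity) hnorm (by linarith)
      _ = M⁻¹ ^ (-(((d : ℝ) - 2) / 2)) * ρ ^ (2 - (d : ℝ)) := by
          rw [Real.mul_rpow (by positivity) (by positivity), ← Real.rpow_natCast ρ,
            ← Real.rpow_mul (by positivity)]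
          congr 2
          push_cast
          ring
  rw [div_mul_eq_mul_div, ENNReal.ofReal_div_of_pos (latticePotential_pos ha 0)]
  refine ENNReal.le_div_iff_mul_le (.inl ?_) (.inl ENNReal.ofReal_ne_top) |>.2 ?_
  · exact (ENNReal.ofReal_pos.2 (latticePotential_pos ha 0)).ne'
  · exact (hitProb_mul_le_of_superharmonic hsuper y).trans (ENNReal.ofReal_le_ofReal hdecay)

/-- Twice the supremum norm of a lattice site, i.e. the side length of the box around the origin
that has the site on its boundary. -/
def boxSide (x : Fin d → ℤ) : ℕ := 2 * Finset.univ.sup fun i => (x i).natAbs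

lemma mem_boxBoundary_boxSide (hd : 0 < d) (x : Fin d → ℤ) : x ∈ boxBoundary d (boxSide x) := by
  have : Nonempty (Fin d) := ⟨⟨0, hd⟩⟩
  refine ⟨fun i => ?_, ?_⟩
  · have hle := Finset.le_sup (f := fun i => (x i).natAbs) (Finset.mem_univ i)
    rw [boxSide, Int.abs_eq_natAbs]
    omega
  · obtain ⟨i, -, hi⟩ := Finset.exists_mem_eq_sup Finset.univ Finset.univ_nonempty
      fun i => (x i).natAbs
    refine ⟨i, ?_⟩
    rw [boxSide, hi, Int.abs_eq_natAbs]
    push_cast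
    rfl

lemma boxSide_le_two_mul_dist (x : Fin d → ℤ) : boxSide x ≤ 2 * (latticeGraph d).dist x 0 := by
  rw [latticeGraph_dist]
  refine Nat.mul_le_mul_left 2 (Finset.sup_le fun i _ => ?_)
  simpa [l1Dist] using Finset.single_le_sum (f := fun i => (x i - (0 : Fin d → ℤ) i).natAbs)
    (fun _ _ => Nat.zero_le _) (Finset.mem_univ i)

lemma boxBoundary_finite (k : ℕ) : (boxBoundary d k).Finite := by
  refine (Set.finite_Icc (fun _ : Fin d => -(k : ℤ)) fun _ => (k : ℤ)).subset fun x hx => ?_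
  have hx' (i : Fin d) : -(k : ℤ) ≤ x i ∧ x i ≤ k :=
    abs_le.1 (by linarith [hx.1 i, abs_nonneg (x i)])
  exact ⟨fun i => (hx' i).1, fun i => (hx' i).2⟩

lemma exists_hitProb_latticeGraph_le_of_mem_ball (hd : 3 ≤ d) {c : ℝ} (hc0 : 0 ≤ c) (hc1 : c < 1) :
    ∃ C > 0, ∀ x : Fin d → ℤ,
      ∀ y ∈ ball (latticeGraph d) x (max 1 (c * (latticeGraph d).dist x 0)),
      hitProb (latticeGraph d) 0 y ≤
        ENNReal.ofReal (C * (max 1 (boxSide x : ℝ)) ^ (2 - (d : ℝ))) := by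
  obtain ⟨C, hC, hhit⟩ := exists_hitProb_latticeGraph_le hd
  have hd3 : (3 : ℝ) ≤ d := mod_cast hd
  have hc : 0 < (1 - c) / 2 := by linarith
  refine ⟨C * ((1 - c) / 2) ^ (2 - (d : ℝ)), by positivity, fun x y hy => ?_⟩
  have hside : (boxSide x : ℝ) ≤ 2 * (latticeGraph d).dist x 0 :=
    mod_cast boxSide_le_two_mul_dist x
  have hfar := one_sub_mul_dist_le_of_mem_ball latticeGraph_connected hc0 hy
  have hscale : (1 - c) / 2 * max 1 (boxSide x : ℝ) ≤ 1 + (latticeGraph d).dist y 0 := by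
    rw [mul_max_of_nonneg _ _ hc.le]
    refine max_le (by linarith [Nat.cast_nonneg (α := ℝ) ((latticeGraph d).dist y 0)]) ?_
    linarith [mul_le_mul_of_nonneg_left hside hc.le]
  refine (hhit y).trans (ENNReal.ofReal_le_ofReal ?_)
  rw [mul_assoc, ← Real.mul_rpow hc.le (by positivity)]
  gcongr ?_ * ?_
  exact Real.rpow_le_rpow_of_nonpos (by positivity) hscale (by linarith)

variable {D0 : SimpleGraph (Fin d → ℤ)} {r : (Fin d → ℤ) → ℝ} {c : ℝ}

lemma summable_boxCount_mul_max_rpow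
    (hsum : Summable fun k : ℕ =>
      (boxCount d D0 (k + 1) : ℝ) * ((k + 1 : ℕ) : ℝ) ^ (2 - (d : ℤ))) :
    Summable fun k : ℕ => (boxCount d D0 k : ℝ) * (max 1 (k : ℝ)) ^ (2 - (d : ℝ)) := by
  refine (summable_nat_add_iff 1).1 (hsum.congr fun k => ?_)
  rw [max_eq_right (by simp), ← Real.rpow_intCast]
  push_cast
  rfl

lemma Sstar_latticeGraph_lt_top (hd : 3 ≤ d) (hc : c < 1)
    (hr : ∀ x, r x ≤ max 1 (c * (latticeGraph d).dist x 0))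
    (hsum : Summable fun k : ℕ =>
      (boxCount d D0 (k + 1) : ℝ) * ((k + 1 : ℕ) : ℝ) ^ (2 - (d : ℤ))) :
    Sstar (latticeGraph d) D0 0 r < ∞ := by
  obtain ⟨C, _, hhit⟩ := exists_hitProb_latticeGraph_le_of_mem_ball (d := d) hd
    (le_max_right c 0) (max_lt hc one_pos)
  set g : ℕ → ℝ≥0∞ := fun k => ENNReal.ofReal (C * (max 1 (k : ℝ)) ^ (2 - (d : ℝ)))
  set S := boundary (latticeGraph d) D0
  have hcard (k : ℕ) : (S ∩ boxSide ⁻¹' {k}).encard ≤ boxCount d D0 k := by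
    rw [boxCount, ((boxBoundary_finite k).inter_of_right _).cast_ncard_eq]
    refine Set.encard_le_encard (Set.inter_subset_inter_right _ ?_)
    rintro x rfl
    exact mem_boxBoundary_boxSide (by omega) x
  calc Sstar (latticeGraph d) D0 0 r
      ≤ ∑' x : S, g (boxSide (x : Fin d → ℤ)) := by
        refine ENNReal.tsum_le_tsum fun x => iSup₂_le fun y hy =>
          hhit x y (ball_subset_ball ((hr x).trans ?_) hy)
        gcongr
        exact le_max_left c 0
    _ = ∑' k, ((S ∩ boxSide ⁻¹' {k}).encard : ℝ≥0∞) * g k := tsum_comp_eq_tsum_encard_mul S _ g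
    _ ≤ ∑' k, (boxCount d D0 k : ℝ≥0∞) * g k :=
        ENNReal.tsum_le_tsum fun k => mul_le_mul_left (mod_cast ENat.toENNReal_le.2 (hcard k)) _
    _ = ∑' k, ENNReal.ofReal (C * (boxCount d D0 k * (max 1 (k : ℝ)) ^ (2 - (d : ℝ)))) := by
        refine tsum_congr fun k => ?_
        rw [← ENNReal.ofReal_natCast, ← ENNReal.ofReal_mul (by positivity), mul_left_comm]
    _ < ∞ := ((summable_boxCount_mul_max_rpow hsum).mul_left C).tsum_ofReal_lt_top

theorem almostSurelyTransient_latticeGraph (hd : 3 ≤ d) (hc : c < 1)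
    (hr : ∀ x, r x ≤ max 1 (c * (latticeGraph d).dist x 0))
    (hsum : Summable fun k : ℕ =>
      (boxCount d D0 (k + 1) : ℝ) * ((k + 1 : ℕ) : ℝ) ^ (2 - (d : ℤ)))
    {Ω : Type*} {mΩ : MeasurableSpace Ω} {μ : Measure Ω} [IsFiniteMeasure μ] {𝓕 : Filtration ℕ mΩ}
    {G : ℕ → Ω → SimpleGraph (Fin d → ℤ)} {Y : ℕ → Ω → Fin d → ℤ}
    (hY : IsExtendedSRW (latticeGraph d) 0 r μ 𝓕 G Y) (hg : IsPOBT (latticeGraph d) D0 μ 𝓕 G Y) :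
    AlmostSurelyTransient μ Y := by
  obtain ⟨K, hK, hbv⟩ := hg.exists_tsum_measure_boundaryVisit_le latticeGraph_neighborSet_finite
    fun x => (latticeGraph_ncard_neighborSet x).le
  exact hY.almostSurelyTransient_of_tsum_boundaryVisit_le hg.toIsTouchGrowth
    latticeGraph_neighborSet_finite latticeGraph_connected
    (stepMean_hitProb_latticeGraph_lt_one hd) (Sstar_latticeGraph_lt_top hd hc hr hsum) hK hbv

end Lattice
end GrowingWalk
end

theorem proposition1p6_general {V : Type*} [MeasurableSpace V] [DiscreteMeasurableSpace V]
    {Gbar G0 : SimpleGraph V} {o : V} {r : V → ℝ} (hconn : Gbar.Connected)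
    (hfin : ∀ x, (Gbar.neighborSet x).Finite) (htr : SRWTransient Gbar o)
    (hS : Sstar Gbar G0 o r < ∞) {Ω : Type*} {mΩ : MeasurableSpace Ω} {μ : Measure Ω}
    [IsFiniteMeasure μ] {𝓕 : Filtration ℕ mΩ} {G : ℕ → Ω → SimpleGraph V} {Y : ℕ → Ω → V}
    (hY : IsExtendedSRW Gbar o r μ 𝓕 G Y) :
    (IsOBT Gbar G0 μ 𝓕 G Y → AlmostSurelyTransient μ Y) ∧
      ((∃ D : ℕ, ∀ x, (Gbar.neighborSet x).ncard ≤ D) →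
        IsPOBT Gbar G0 μ 𝓕 G Y → AlmostSurelyTransient μ Y) := by
  have := countable_of_connected hconn fun x => (hfin x).countable
  have hret := stepMean_hitProb_self_lt_one hconn hfin htr
  refine ⟨fun hg => ?_, fun ⟨D, hD⟩ hg => ?_⟩
  · exact hY.almostSurelyTransient_of_tsum_boundaryVisit_le hg.toIsTouchGrowth hfin hconn hret hS
      (measure_ne_top μ _) (hg.tsum_measure_boundaryVisit_le hfin)
  · obtain ⟨K, hK, hbv⟩ := hg.exists_tsum_measure_boundaryVisit_le hfin hD
    exact hY.almostSurelyTransient_of_tsum_boundaryVisit_le hg.toIsTouchGrowth hfin hconn hret hS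
      hK hbv

theorem proposition1p6 :
    -- general graphs
    (∀ (V : Type*) [MeasurableSpace V] [DiscreteMeasurableSpace V]
      (Gbar G0 : SimpleGraph V) (o : V) (r : V → ℝ),
      Gbar.Connected → (∀ x, (Gbar.neighborSet x).Finite) → SRWTransient Gbar o →
      G0 ≤ Gbar → (∀ y, Gbar.Adj o y → G0.Adj o y) →
      IsJumpRadius Gbar o r → Sstar Gbar G0 o r < ∞ →
      ∀ (Ω : Type*) [mΩ : MeasurableSpace Ω] (μ : Measure Ω) [IsProbabilityMeasure μ]
        (𝓕 : Filtration ℕ mΩ) (G : ℕ → Ω → SimpleGraph V) (Y : ℕ → Ω → V),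
        IsExtendedSRW Gbar o r μ 𝓕 G Y →
        (IsOBT Gbar G0 μ 𝓕 G Y → AlmostSurelyTransient μ Y) ∧
        ((∃ D : ℕ, ∀ x, (Gbar.neighborSet x).ncard ≤ D) →
          IsPOBT Gbar G0 μ 𝓕 G Y → AlmostSurelyTransient μ Y)) ∧
    -- the integer lattice
    (∀ (d : ℕ), 3 ≤ d →
      ∀ (D0 : SimpleGraph (Fin d → ℤ)) (r : (Fin d → ℤ) → ℝ),
      D0 ≤ latticeGraph d → (∀ y, (latticeGraph d).Adj 0 y → D0.Adj 0 y) →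
      IsJumpRadius (latticeGraph d) 0 r →
      Summable (fun k : ℕ =>
        (boxCount d D0 (k + 1) : ℝ) * ((k + 1 : ℕ) : ℝ) ^ (2 - (d : ℤ))) →
      ∀ (Ω : Type*) [mΩ : MeasurableSpace Ω] (μ : Measure Ω) [IsProbabilityMeasure μ]
        (𝓕 : Filtration ℕ mΩ) (G : ℕ → Ω → SimpleGraph (Fin d → ℤ))
        (Y : ℕ → Ω → (Fin d → ℤ)),
        IsExtendedSRW (latticeGraph d) 0 r μ 𝓕 G Y →
        IsPOBT (latticeGraph d) D0 μ 𝓕 G Y → AlmostSurelyTransient μ Y) :=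
  ⟨fun _ _ _ _ _ _ _ hconn hfin htr _ _ _ hS _ _ _ _ _ _ _ hY =>
      proposition1p6_general hconn hfin htr hS hY,
    fun _ hd _ _ _ _ ⟨_, hc, hr⟩ hsum _ _ _ _ _ _ _ hY hg =>
      almostSurelyTransient_latticeGraph hd hc (fun x => (hr x).2) hsum hY hg⟩
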